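/- Let $v_1\neq v_2$ be real numbers, $\alpha_{12},\alpha_{21}>0$, $c_1,c_2>0$ with $c_1+c_2=1$. For $N=1,2,\dots$ put $N_i=[c_iN]$, $i=1,2$, and consider $N_1$ particles of type $1$ and $N_2$ particles of type $2$ on the real line, with coordinates $x^{(i)}_k(t)$, $k=1,\dots,N_i$, $t\ge 0$. Each particle of type $i$ moves with constant velocity $v_i$; moreover, independently of all others, each particle of type $i$ jumps to the current position of any given particle of type $j\ne i$ with rate $\alpha_{ij}/N_j$ (there are no jumps between particles of the same type), after which it continues to move with velocity $v_i$. The initial coordinates are given (for every $N$). Let $$\overline{x^{(i)}}(t)=\frac1{N_i}\sum_{k=1}^{N_i}x^{(i)}_k(t),\qquad S_i^2(t)=\frac1{N_i}\sum_{k=1}^{N_i}\bigl(x^{(i)}_k(t)-\overline{x^{(i)}}(t)\bigr)^2,\qquad R_i(t)=\mathsf E\,S_i^2(t),$$ and suppose that the initial quantities $S_1^2(0)$, $S_2^2(0)$ and $|\overline{x^{(1)}}(0)-\overline{x^{(2)}}(0)|$ are bounded uniformly in $N$. Put $$\varkappa_2=\frac{2}{Z}\left(\frac{\alpha_{21}}{c_1}+\frac{\alpha_{12}}{c_2}\right),\quad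 Z=(\alpha_{12}+\alpha_{21})\left(\frac1{\alpha_{12}}+\frac1{\alpha_{21}}\right),\qquad h=\frac{2\alpha_{12}\alpha_{21}(v_1-v_2)^2}{\varkappa_2(\alpha_{12}+\alpha_{21})^3}.$$ Then $\varkappa_2>0$ and, for $i=1,2$, as $N\to\infty$: 1. if $t(N)\to\infty$ and $t(N)/N\to0$, then $R_i(t(N))\sim h\varkappa_2\,t(N)$; 2. if $t(N)=sN$ for some $s>0$, then $R_i(t(N))\sim h(1-e^{-\varkappa_2 s})N$; 3. if $t(N)/N\to\infty$, then $R_i(t(N))\sim hN$. These asymptotics are uniform in the time: for every $\varepsilon>0$, 1. there are $\delta>0$, $T$ and $N_0$ such that $|R_i(t)-h\varkappa_2t|\le\varepsilon h\varkappa_2t$ for all $N\ge N_0$ and $T\le t\le\delta N$; 2. for every $s_0>0$ there is $N_0$ such that $|R_i(sN)-h(1-e^{-\varkappa_2s})N|\le\varepsilon h(1-e^{-\varkappa_2s})N$ for all $N\ge N_0$ and $s\ge s_0$; 3. there are $K>0$ and $N_0$ such that $|R_i(t)-hN|\le\varepsilon hN$ for all $N\ge N_0$ and $t\ge KN$. 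-/

import Mathlib

open MeasureTheory ProbabilityTheory Filter Topology Asymptotics

namespace TimeSync

noncomputable section

/-- The particles: `⟨i, k⟩` is the `k`-th particle of type `i`. There are `N i` particles of
type `i`, where the two types `1, 2` are indexed by `0, 1 : Fin 2`. -/
abbrev Particle (N : Fin 2 → ℕ) : Type := Σ i : Fin 2, Fin (N i)

/-- All sets of particles are measurable. -/
instance (N : Fin 2 → ℕ) : DiscreteMeasurableSpace (Particle N) where
  forall_measurableSet s := by
    refine MeasurableSpace.measurableSet_iInf.2 fun i => ?_
    exact MeasurableSet.of_discrete (s := Sigma.mk i ⁻¹' s)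

/-- A configuration: the coordinates of all particles on the real line. -/
abbrev Config (N : Fin 2 → ℕ) : Type := Particle N → ℝ

/-- A jump `(p, q)`: particle `p` jumps to the place of particle `q`. -/
abbrev Jump (N : Fin 2 → ℕ) : Type := Particle N × Particle N

/-- Deterministic motion during a time `s`: particles of type `i` have velocity `v i`. -/
def drift (N : Fin 2 → ℕ) (v : Fin 2 → ℝ) (s : ℝ) (x : Config N) : Config N :=
  fun p => x p + v p.1 * s

/-- The configuration after the jump `m`. -/
def applyJump (N : Fin 2 → ℕ) (m : Jump N) (x : Config N) : Config N :=
  Function.update x m.1 (x m.2)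

/-- A particle of type `i` decides at rate `α i j` to jump to a particle of type `j`, which it
chooses uniformly: it jumps to any given particle of type `j` at rate `α i j / N j`. -/
def jumpRate (N : Fin 2 → ℕ) (α : Fin 2 → Fin 2 → ℝ) (m : Jump N) : ℝ :=
  α m.1.1 m.2.1 / N m.2.1

/-- The total jump rate of the system. It does not depend on the configuration. -/
def totalRate (N : Fin 2 → ℕ) (α : Fin 2 → Fin 2 → ℝ) : ℝ :=
  ∑ m : Jump N, jumpRate N α m

/-- The law of the next jump: `m` is chosen with probability `jumpRate m / totalRate`. -/
def jumpLaw (N : Fin 2 → ℕ) (α : Fin 2 → Fin 2 → ℝ) : Measure (Jump N) :=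
  ∑ m : Jump N, ENNReal.ofReal (jumpRate N α m / totalRate N α) • Measure.dirac m

/-- The joint law of a holding time and of the jump that ends it: the holding time is exponential
with parameter `totalRate`, and the jump is independent of it. -/
def stepLaw (N : Fin 2 → ℕ) (α : Fin 2 → Fin 2 → ℝ) : Measure (ℝ × Jump N) :=
  (expMeasure (totalRate N α)).prod (jumpLaw N α)

/-- If the rates are nonnegative and not all zero, `stepLaw` is a probability measure. -/
theorem isProbabilityMeasure_stepLaw (N : Fin 2 → ℕ) (α : Fin 2 → Fin 2 → ℝ)
    (hα : ∀ i j, 0 ≤ α i j) (h : 0 < totalRate N α) :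
    IsProbabilityMeasure (stepLaw N α) := by
  have h1 : IsProbabilityMeasure (expMeasure (totalRate N α)) := isProbabilityMeasure_expMeasure h
  have h2 : IsProbabilityMeasure (jumpLaw N α) := by
    constructor
    have hr : ∀ m : Jump N, 0 ≤ jumpRate N α m / totalRate N α := fun m =>
      div_nonneg (div_nonneg (hα _ _) (Nat.cast_nonneg _)) h.le
    simp only [jumpLaw, Measure.coe_finsetSum, Finset.sum_apply, Measure.smul_apply,
      measure_univ, smul_eq_mul, mul_one]
    rw [← ENNReal.ofReal_sum_of_nonneg fun m _ => hr m, ← Finset.sum_div]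
    change ENNReal.ofReal (totalRate N α / totalRate N α) = 1
    rw [div_self h.ne', ENNReal.ofReal_one]
  unfold stepLaw
  infer_instance

open Classical in
/-- The law of the sequence of all holding times and jumps, which are independent from step to
step. (The second branch only concerns systems in which there are no jumps.) -/
def noiseLaw (N : Fin 2 → ℕ) (α : Fin 2 → Fin 2 → ℝ) : Measure (ℕ → ℝ × Jump N) :=
  if _h : IsProbabilityMeasure (stepLaw N α) then Measure.infinitePi (fun _ => stepLaw N α) else 0

/-- The time of the `n`-th jump, with `jumpTime N ω 0 = 0`. -/
def jumpTime (N : Fin 2 → ℕ) (ω : ℕ → ℝ × Jump N) (n : ℕ) : ℝ :=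
  ∑ k ∈ Finset.range n, (ω k).1

/-- The configuration immediately after the `n`-th jump, started from `x₀`. -/
def embedded (N : Fin 2 → ℕ) (v : Fin 2 → ℝ) (x₀ : Config N) (ω : ℕ → ℝ × Jump N) :
    ℕ → Config N
  | 0 => x₀
  | n + 1 => applyJump N (ω n).2 (drift N v (ω n).1 (embedded N v x₀ ω n))

/-- The number of jumps up to time `t`, i.e. the first `n` for which the `(n+1)`-st jump comes
after `t`. -/
def jumpCount (N : Fin 2 → ℕ) (ω : ℕ → ℝ × Jump N) (t : ℝ) : ℕ :=
  sInf {n | t < jumpTime N ω (n + 1)}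

/-- The continuous time Markov process `ξ(t)`, `t ≥ 0`, started from `x₀`. -/
def process (N : Fin 2 → ℕ) (v : Fin 2 → ℝ) (x₀ : Config N) (t : ℝ) (ω : ℕ → ℝ × Jump N) :
    Config N :=
  drift N v (t - jumpTime N ω (jumpCount N ω t)) (embedded N v x₀ ω (jumpCount N ω t))

/-- The empirical mean of type `i`. -/
def empMean (N : Fin 2 → ℕ) (i : Fin 2) (x : Config N) : ℝ :=
  (1 / (N i : ℝ)) * ∑ k : Fin (N i), x ⟨i, k⟩

/-- The empirical variance of type `i`. -/
def empVar (N : Fin 2 → ℕ) (i : Fin 2) (x : Config N) : ℝ :=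
  (1 / (N i : ℝ)) * ∑ k : Fin (N i), (x ⟨i, k⟩ - empMean N i x) ^ 2

/-- `R_i(t)`, the expected empirical variance of type `i` at time `t`. -/
def R (N : Fin 2 → ℕ) (v : Fin 2 → ℝ) (α : Fin 2 → Fin 2 → ℝ) (x₀ : Config N) (i : Fin 2)
    (t : ℝ) : ℝ :=
  ∫ ω, empVar N i (process N v x₀ t ω) ∂(noiseLaw N α)

/-- The constant `ϰ₂ = 2 Z⁻¹ (α₂₁ / c₁ + α₁₂ / c₂)`, with
`Z = (α₁₂ + α₂₁) (1 / α₁₂ + 1 / α₂₁)`. -/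
def kappa₂ (α : Fin 2 → Fin 2 → ℝ) (c : Fin 2 → ℝ) : ℝ :=
  2 * ((α 0 1 + α 1 0) * (1 / α 0 1 + 1 / α 1 0))⁻¹ * (α 1 0 / c 0 + α 0 1 / c 1)

/-- The constant `h = 2 α₁₂ α₂₁ (v₁ - v₂)² / (ϰ₂ (α₁₂ + α₂₁)³)`. -/
def hConst (v : Fin 2 → ℝ) (α : Fin 2 → Fin 2 → ℝ) (c : Fin 2 → ℝ) : ℝ :=
  2 * α 0 1 * α 1 0 * (v 0 - v 1) ^ 2 / (kappa₂ α c * (α 0 1 + α 1 0) ^ 3)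

/-- The numbers of particles `N_i = [c_i N]`. -/
def sizes (c : Fin 2 → ℝ) (N : ℕ) (i : Fin 2) : ℕ := ⌊c i * N⌋₊

end

end TimeSync

/-!
Let `D` be the signed distance of the two mass centres. The generator of the process maps the span
of `1, D, D², S₁², S₂²` to itself, so the expectations `d = E D`, `u = E D²`, `r = R₁`, `s = R₂`
solve a linear system of ordinary differential equations, and the theorem becomes a
statement about this system that has to be uniform in the number of particles and in time.

*From the process to the equations.* The process is built from its holding times and jumps, so the
generator enters through the renewal equation obtained by conditioning on the first step
(`integral_process_eq_step`). The matrix exponential of the generator, applied to the vector of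
observables, solves the same equation (`exp_smul_generator_eq_step`). As the coordinates grow at
most linearly in time, both sides are bounded where they are needed, and one step up to time `T`
contracts by `1 - e ^ (-λ T)`, with `λ` the total jump rate. This gives Dynkin's formula
(`integral_process_eq_exp`) and the moment equations (`exists_isMomentSolution`).

*The equations.* Write `a = α₁₂`, `b = α₂₁`, `w = v₁ - v₂`, `p = 1 / N₁`, `q = 1 / N₂`. In the
combination `W = b r + a s + a b / (a + b) u + 2 a b w / (a + b)² d` the terms of order one cancel
and exactly
`W' = 2 a b w² / (a + b)² - a b / (a + b) (b p + a q) (r + s + u)`.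
This shows that `r + s + u` is at most of the order of the number of particles, hence that the terms
with `p` and `q` in the equations of `u` and of `r - s` are bounded, and since these two variables
relax at rates of order one, they stay bounded themselves. Consequently `r + s + u` is
`2 W / (a + b)` up to a bounded error, `W` relaxes at the rate
`ν = 2 a b / (a + b)² (b p + a q) ∼ ϰ₂ / N`, and
`Rᵢ = h ϰ₂ (1 - e ^ (-ν t)) / ν + O(1)` uniformly (`IsMomentSolution.exists_abs_sub_le`).

*The regimes.* The function `(1 - e ^ (-ν t)) / ν` depends on `ν` relatively continuously, uniformly
in `t` (`abs_relaxation_sub_le`), so `Rᵢ(t)` is `h N (1 - e ^ (-ϰ₂ t / N))` up to a small relative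
and a bounded absolute error (`eventually_abs_R_sub_le`). The three regimes are read off from this.
-/

namespace TimeSync

/-! ### The first entry of an i.i.d. sequence -/

/-- The sequence `a, ω 0, ω 1, …`. -/
def prepend {X : Type*} (a : X) (ω : ℕ → X) : ℕ → X
  | 0 => a
  | n + 1 => ω n

theorem measurable_prepend {X : Type*} [MeasurableSpace X] :
    Measurable fun p : X × (ℕ → X) => prepend p.1 p.2 := by
  refine measurable_pi_lambda _ fun n => ?_
  cases n with
  | zero => exact measurable_fst
  | succ n => exact (measurable_pi_apply n).comp measurable_snd

/-- An i.i.d. sequence is a first entry followed by an independent copy of the sequence. -/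
theorem map_prepend_infinitePi {X : Type*} [MeasurableSpace X] (μ : Measure X)
    [IsProbabilityMeasure μ] :
    (μ.prod (Measure.infinitePi fun _ : ℕ => μ)).map (fun p => prepend p.1 p.2)
      = Measure.infinitePi fun _ : ℕ => μ := by
  classical
  refine Measure.eq_infinitePi _ fun s t ht => ?_
  rw [Measure.map_apply measurable_prepend (.pi s.countable_toSet fun _ _ => ht _)]
  -- enlarge the index set to an initial segment
  obtain ⟨n, hn⟩ : ∃ n, s ⊆ Finset.range (n + 1) :=
    ⟨s.sup id, fun i hi => Finset.mem_range.2 (Nat.lt_succ_of_le (Finset.le_sup (f := id) hi))⟩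
  set t' : ℕ → Set X := fun i => if i ∈ s then t i else Set.univ with ht'
  have hpre : (fun p : X × (ℕ → X) => prepend p.1 p.2) ⁻¹' (Set.pi s t)
      = t' 0 ×ˢ Set.pi (Finset.range n) (fun i => t' (i + 1)) := by
    ext ⟨a, ω⟩
    simp only [Set.mem_preimage, Set.mem_pi, Set.mem_prod, SetLike.mem_coe, Finset.mem_range, ht']
    constructor
    · intro h
      refine ⟨?_, fun i _ => ?_⟩
      · split_ifs with h0
        · exact h 0 h0
        · trivial
      · split_ifs with h0
        · exact h (i + 1) h0
        · trivial
    · rintro ⟨h0, h1⟩ i hi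
      cases i with
      | zero => rw [if_pos hi] at h0; exact h0
      | succ i =>
        have := h1 i (by have := Finset.mem_range.1 (hn hi); omega)
        rw [if_pos hi] at this
        exact this
  have hmeas : ∀ i, MeasurableSet (t' i) := fun i => by
    simp only [ht']
    split_ifs
    exacts [ht i, MeasurableSet.univ]
  rw [hpre, Measure.prod_prod, Measure.infinitePi_pi _ (fun i _ => hmeas _)]
  have : ∏ i ∈ s, μ (t i) = ∏ i ∈ Finset.range (n + 1), μ (t' i) := by
    rw [← Finset.prod_subset hn (f := fun i => μ (t' i))]
    · exact Finset.prod_congr rfl fun i hi => by simp [ht', hi]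
    · intro i _ hi
      simp [ht', hi]
  rw [this, Finset.prod_range_succ', mul_comm]

theorem integral_infinitePi_eq_integral_prepend {X E : Type*} [MeasurableSpace X]
    [NormedAddCommGroup E] [NormedSpace ℝ E] (μ : Measure X) [IsProbabilityMeasure μ]
    {f : (ℕ → X) → E} (hf : Integrable f (Measure.infinitePi fun _ : ℕ => μ)) :
    Integrable (fun a => ∫ ω, f (prepend a ω) ∂(Measure.infinitePi fun _ : ℕ => μ)) μ ∧
    ∫ ω, f ω ∂(Measure.infinitePi fun _ : ℕ => μ)
      = ∫ a, ∫ ω, f (prepend a ω) ∂(Measure.infinitePi fun _ : ℕ => μ) ∂μ := by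
  have hm := map_prepend_infinitePi μ
  have hint : Integrable (fun p : X × (ℕ → X) => f (prepend p.1 p.2))
      (μ.prod (Measure.infinitePi fun _ : ℕ => μ)) := by
    rw [← hm] at hf
    exact hf.comp_measurable measurable_prepend
  refine ⟨hint.integral_prod_left, ?_⟩
  rw [← integral_prod _ hint]
  conv_lhs => rw [← hm]
  rw [integral_map measurable_prepend.aemeasurable]
  rw [hm]; exact hf.1

/-! ### Jump times -/

variable {N : Fin 2 → ℕ}

theorem jumpTime_prepend (a : ℝ × Jump N) (ω : ℕ → ℝ × Jump N) (n : ℕ) :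
    jumpTime N (prepend a ω) (n + 1) = a.1 + jumpTime N ω n := by
  simp only [jumpTime, Finset.sum_range_succ']
  rw [add_comm]; rfl

theorem jumpTime_succ (ω : ℕ → ℝ × Jump N) (n : ℕ) :
    jumpTime N ω (n + 1) = jumpTime N ω n + (ω n).1 := Finset.sum_range_succ _ _

theorem measurable_jumpTime (n : ℕ) : Measurable fun ω : ℕ → ℝ × Jump N => jumpTime N ω n :=
  Finset.measurable_fun_sum _ fun k _ => (measurable_pi_apply k).fst

theorem embedded_prepend (v : Fin 2 → ℝ) (x : Config N) (a : ℝ × Jump N) (ω : ℕ → ℝ × Jump N)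
    (n : ℕ) : embedded N v x (prepend a ω) (n + 1)
      = embedded N v (applyJump N a.2 (drift N v a.1 x)) ω n := by
  induction n with
  | zero => rfl
  | succ n ih =>
    rw [embedded, ih]
    rfl

theorem process_prepend_of_lt (v : Fin 2 → ℝ) (x : Config N) {t : ℝ} {a : ℝ × Jump N}
    (ω : ℕ → ℝ × Jump N) (h : t < a.1) :
    process N v x t (prepend a ω) = drift N v t x := by
  have : jumpCount N (prepend a ω) t = 0 := by
    refine Nat.sInf_eq_zero.2 (Or.inl ?_)
    simpa [jumpTime, prepend] using h
  rw [process, this]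
  simp [jumpTime, embedded]

theorem process_prepend_of_le (v : Fin 2 → ℝ) (x : Config N) {t : ℝ} {a : ℝ × Jump N}
    {ω : ℕ → ℝ × Jump N} (h : a.1 ≤ t) (hω : ∃ n, t - a.1 < jumpTime N ω (n + 1)) :
    process N v x t (prepend a ω)
      = process N v (applyJump N a.2 (drift N v a.1 x)) (t - a.1) ω := by
  have hset : {n | t - a.1 < jumpTime N ω (n + 1)}
      = {n | n + 1 ∈ {n | t < jumpTime N (prepend a ω) (n + 1)}} := by
    ext n
    simp only [Set.mem_ofPred_eq, jumpTime_prepend]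
    constructor <;> intro h <;> linarith
  have h0 : 0 ∉ {n | t < jumpTime N (prepend a ω) (n + 1)} := by
    simp only [Set.mem_ofPred_eq, jumpTime_prepend]
    simpa [jumpTime] using h
  have hc : jumpCount N (prepend a ω) t = jumpCount N ω (t - a.1) + 1 := by
    unfold jumpCount
    rw [hset]
    refine (Nat.sInf_add (p := fun n => t < jumpTime N (prepend a ω) (n + 1)) (n := 1) ?_).symm
    by_contra hcon
    have hz : sInf {n | t < jumpTime N (prepend a ω) (n + 1)} = 0 := by omega
    rcases Nat.sInf_eq_zero.1 hz with h1 | h1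
    · exact h0 h1
    · obtain ⟨n, hn⟩ := hω
      have : n + 1 ∈ {n | t < jumpTime N (prepend a ω) (n + 1)} := by
        have : n ∈ {n | t - a.1 < jumpTime N ω (n + 1)} := hn
        rw [hset] at this
        exact this
      rw [h1] at this
      exact this
  rw [process, hc, process, embedded_prepend, jumpTime_prepend, sub_sub]

/-! ### Measurability -/

theorem measurable_drift (v : Fin 2 → ℝ) :
    Measurable fun p : ℝ × Config N => drift N v p.1 p.2 := by
  unfold drift
  fun_prop

theorem continuous_drift (v : Fin 2 → ℝ) :
    Continuous fun p : ℝ × Config N => drift N v p.1 p.2 := by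
  unfold drift
  fun_prop

theorem continuous_applyJump (m : Jump N) : Continuous (applyJump N m) :=
  continuous_id.update _ (continuous_apply _)

theorem measurable_applyJump :
    Measurable fun p : Jump N × Config N => applyJump N p.1 p.2 :=
  measurable_from_prod_countable_right fun m => (continuous_applyJump m).measurable

theorem measurable_embedded (v : Fin 2 → ℝ) (x : Config N) (n : ℕ) :
    Measurable fun ω : ℕ → ℝ × Jump N => embedded N v x ω n := by
  induction n with
  | zero => exact measurable_const
  | succ n ih =>
    exact measurable_applyJump.comp ((measurable_pi_apply n).snd.prodMk
      ((measurable_drift v).comp ((measurable_pi_apply n).fst.prodMk ih)))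

theorem measurable_jumpCount (t : ℝ) : Measurable fun ω : ℕ → ℝ × Jump N => jumpCount N ω t := by
  classical
  have hA : ∀ n, MeasurableSet {ω : ℕ → ℝ × Jump N | t < jumpTime N ω (n + 1)} := fun n =>
    measurableSet_lt measurable_const (measurable_jumpTime _)
  refine measurable_to_countable' fun n => ?_
  cases n with
  | zero =>
    have : (fun ω : ℕ → ℝ × Jump N => jumpCount N ω t) ⁻¹' {0}
        = {ω | t < jumpTime N ω (0 + 1)} ∪ ⋂ n, {ω | t < jumpTime N ω (n + 1)}ᶜ := by
      ext ω
      simp only [Set.mem_preimage, Set.mem_singleton_iff, jumpCount, Nat.sInf_eq_zero,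
        Set.mem_union, Set.mem_iInter, Set.mem_compl_iff, Set.mem_ofPred_eq,
        Set.eq_empty_iff_forall_notMem]
    rw [this]
    exact (hA 0).union (MeasurableSet.iInter fun n => (hA n).compl)
  | succ n =>
    have : (fun ω : ℕ → ℝ × Jump N => jumpCount N ω t) ⁻¹' {n + 1}
        = {ω | t < jumpTime N ω (n + 1 + 1)} ∩
          ⋂ k ∈ Finset.range (n + 1), {ω | t < jumpTime N ω (k + 1)}ᶜ := by
      ext ω
      simp only [Set.mem_preimage, Set.mem_singleton_iff, Set.mem_inter_iff, Set.mem_iInter,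
        Set.mem_compl_iff, Set.mem_ofPred_eq, Finset.mem_range]
      constructor
      · intro h
        refine ⟨?_, fun k hk hk' => ?_⟩
        · have := Nat.sInf_mem (Nat.nonempty_of_sInf_eq_succ h)
          rw [show sInf {n | t < jumpTime N ω (n + 1)} = n + 1 from h] at this
          exact this
        · have := Nat.sInf_le (s := {n | t < jumpTime N ω (n + 1)}) hk'
          have h' : sInf {n | t < jumpTime N ω (n + 1)} = n + 1 := h
          omega
      · rintro ⟨h1, h2⟩
        refine le_antisymm (Nat.sInf_le h1) (le_csInf ⟨_, h1⟩ fun k hk => ?_)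
        by_contra hlt
        exact h2 k (by omega) hk
    rw [this]
    exact (hA _).inter (Finset.measurableSet_biInter _ fun k _ => (hA k).compl)

theorem measurable_process (v : Fin 2 → ℝ) (x : Config N) (t : ℝ) :
    Measurable (process N v x t) := by
  have h : Measurable fun p : ℕ × (ℕ → ℝ × Jump N) =>
      drift N v (t - jumpTime N p.2 p.1) (embedded N v x p.2 p.1) :=
    measurable_from_prod_countable_right fun n => (measurable_drift v).comp
      ((measurable_const.sub (measurable_jumpTime n)).prodMk (measurable_embedded v x n))
  exact h.comp ((measurable_jumpCount t).prodMk measurable_id)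

/-! ### Bounds on the coordinates -/

theorem norm_drift_le (v : Fin 2 → ℝ) {s : ℝ} (hs : 0 ≤ s) (x : Config N) :
    ‖drift N v s x‖ ≤ ‖x‖ + ‖v‖ * s := by
  refine (pi_norm_le_iff_of_nonneg (by positivity)).2 fun p => ?_
  refine (norm_add_le _ _).trans (add_le_add (norm_le_pi_norm x p) ?_)
  rw [norm_mul, Real.norm_of_nonneg hs]
  exact mul_le_mul_of_nonneg_right (norm_le_pi_norm v p.1) hs

theorem norm_applyJump_le (m : Jump N) (x : Config N) : ‖applyJump N m x‖ ≤ ‖x‖ := by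
  refine (pi_norm_le_iff_of_nonneg (norm_nonneg _)).2 fun p => ?_
  unfold applyJump
  by_cases h : p = m.1
  · subst h
    simpa using norm_le_pi_norm x m.2
  · rw [Function.update_of_ne h]
    exact norm_le_pi_norm x p

theorem norm_embedded_le (v : Fin 2 → ℝ) (x : Config N) {ω : ℕ → ℝ × Jump N}
    (hω : ∀ k, 0 ≤ (ω k).1) (n : ℕ) : ‖embedded N v x ω n‖ ≤ ‖x‖ + ‖v‖ * jumpTime N ω n := by
  induction n with
  | zero => simp [embedded, jumpTime]
  | succ n ih =>
    calc ‖embedded N v x ω (n + 1)‖ ≤ ‖drift N v (ω n).1 (embedded N v x ω n)‖ :=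
          norm_applyJump_le _ _
      _ ≤ ‖embedded N v x ω n‖ + ‖v‖ * (ω n).1 := norm_drift_le v (hω n) _
      _ ≤ ‖x‖ + ‖v‖ * jumpTime N ω (n + 1) := by rw [jumpTime_succ]; linarith

/-- The last jump before time `t ≥ 0` is not after `t`. -/
theorem jumpTime_jumpCount_le {ω : ℕ → ℝ × Jump N} {t : ℝ} (ht : 0 ≤ t) :
    jumpTime N ω (jumpCount N ω t) ≤ t := by
  rcases h : jumpCount N ω t with _ | n
  · simpa [jumpTime] using ht
  · by_contra hlt
    have h' : sInf {n | t < jumpTime N ω (n + 1)} = n + 1 := h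
    have := Nat.sInf_le (s := {n | t < jumpTime N ω (n + 1)}) (not_le.1 hlt)
    omega

theorem norm_process_le (v : Fin 2 → ℝ) (x : Config N) {ω : ℕ → ℝ × Jump N}
    (hω : ∀ k, 0 ≤ (ω k).1) {t : ℝ} (ht : 0 ≤ t) : ‖process N v x t ω‖ ≤ ‖x‖ + ‖v‖ * t := by
  have h1 := norm_drift_le v (sub_nonneg.2 (jumpTime_jumpCount_le (ω := ω) ht))
    (embedded N v x ω (jumpCount N ω t))
  have h2 := norm_embedded_le v x hω (jumpCount N ω t)
  unfold process
  linarith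

/-! ### Integration against the law of a step -/

theorem expMeasure_real_Iic {r : ℝ} (hr : 0 < r) {t : ℝ} (ht : 0 ≤ t) :
    (expMeasure r).real (Set.Iic t) = 1 - Real.exp (-(r * t)) := by
  have := isProbabilityMeasure_expMeasure hr
  rw [← cdf_eq_real, cdf_expMeasure_eq hr, if_pos ht]

theorem ae_nonneg_expMeasure (r : ℝ) : ∀ᵐ s ∂(expMeasure r), 0 ≤ s := by
  have h : expMeasure r (Set.Iio 0) = 0 := by
    rw [expMeasure, gammaMeasure, withDensity_apply _ measurableSet_Iio]
    exact lintegral_gammaPDF_of_nonpos le_rfl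
  rw [ae_iff]
  simpa only [not_le] using! h

theorem integral_expMeasure {E : Type*} [NormedAddCommGroup E] [NormedSpace ℝ E] {r : ℝ}
    (hr : 0 < r) (f : ℝ → E) :
    ∫ s, f s ∂(expMeasure r) = ∫ s in Set.Ici 0, (r * Real.exp (-(r * s))) • f s := by
  have h1 : expMeasure r = volume.withDensity (exponentialPDF r) := rfl
  rw [h1, integral_withDensity_eq_integral_toReal_smul, ← integral_indicator measurableSet_Ici]
  · refine integral_congr_ae (Eventually.of_forall fun s => ?_)
    simp only [Set.indicator_apply, Set.mem_Ici, exponentialPDF_eq]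
    split_ifs
    · rw [ENNReal.toReal_ofReal (by positivity)]
    · simp
  · exact (measurable_exponentialPDFReal r).ennreal_ofReal
  · exact Eventually.of_forall fun s => ENNReal.ofReal_lt_top

/-- A function of an exponential time which is frozen after time `t`. -/
theorem integral_expMeasure_ite {E : Type*} [NormedAddCommGroup E] [NormedSpace ℝ E]
    [CompleteSpace E] {r : ℝ} (hr : 0 < r) {t : ℝ} (ht : 0 ≤ t) {f : ℝ → E} (hf : Continuous f)
    (k : E) :
    ∫ s, (if t < s then k else f s) ∂(expMeasure r)
      = Real.exp (-(r * t)) • k + ∫ s in (0)..t, (r * Real.exp (-(r * s))) • f s := by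
  have hsplit : Set.Ici (0 : ℝ) = Set.Icc 0 t ∪ Set.Ioi t := (Set.Icc_union_Ioi_eq_Ici ht).symm
  have hIcc : Set.EqOn (fun s => (r * Real.exp (-(r * s))) • (if t < s then k else f s))
      (fun s => (r * Real.exp (-(r * s))) • f s) (Set.Icc 0 t) := fun s hs => by
    simp only [if_neg (not_lt.2 hs.2)]
  have hIoi : Set.EqOn (fun s => (r * Real.exp (-(r * s))) • (if t < s then k else f s))
      (fun s => (r * Real.exp (-(r * s))) • k) (Set.Ioi t) := fun s hs => by
    simp only [if_pos (Set.mem_Ioi.1 hs)]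
  have hexp : IntegrableOn (fun s => r * Real.exp (-(r * s))) (Set.Ioi t) := by
    have := (exp_neg_integrableOn_Ioi t hr).const_mul r
    simpa only [neg_mul] using! this
  have hval : ∫ s in Set.Ioi t, r * Real.exp (-(r * s)) = Real.exp (-(r * t)) := by
    rw [integral_const_mul]
    have := integral_exp_mul_Ioi (neg_lt_zero.2 hr) t
    simp only [neg_mul] at this
    rw [this]
    field_simp
  have hcont : Continuous fun s => (r * Real.exp (-(r * s))) • f s := by fun_prop
  rw [integral_expMeasure hr, hsplit, setIntegral_union _ measurableSet_Ioi]
  · rw [setIntegral_congr_fun measurableSet_Icc hIcc, setIntegral_congr_fun measurableSet_Ioi hIoi,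
      integral_smul_const, hval, integral_Icc_eq_integral_Ioc,
      ← intervalIntegral.integral_of_le ht, add_comm]
  · exact (hcont.continuousOn.integrableOn_Icc).congr_fun hIcc.symm measurableSet_Icc
  · exact IntegrableOn.congr_fun (hexp.smul_const k) hIoi.symm measurableSet_Ioi
  · rw [Set.disjoint_left]
    intro s hs hs'
    exact absurd hs.2 (not_le.2 hs')

theorem isProbabilityMeasure_jumpLaw {α : Fin 2 → Fin 2 → ℝ} (hα : ∀ i j, 0 ≤ α i j)
    (h : 0 < totalRate N α) : IsProbabilityMeasure (jumpLaw N α) := by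
  have h1 := isProbabilityMeasure_stepLaw N α hα h
  have h2 := isProbabilityMeasure_expMeasure h
  have h3 : stepLaw N α (Set.univ ×ˢ Set.univ) = 1 := by rw [Set.univ_prod_univ]; exact measure_univ
  rw [stepLaw, jumpLaw] at h3
  have : IsFiniteMeasure (jumpLaw N α) := by
    unfold jumpLaw
    have : ∀ m : Jump N, IsFiniteMeasure
        (ENNReal.ofReal (jumpRate N α m / totalRate N α) • Measure.dirac m) := fun m =>
      Measure.smul_finite _ ENNReal.ofReal_ne_top
    infer_instance
  rw [← jumpLaw, Measure.prod_prod, measure_univ, one_mul] at h3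
  exact ⟨h3⟩

theorem integral_jumpLaw {E : Type*} [NormedAddCommGroup E] [NormedSpace ℝ E] [CompleteSpace E]
    {α : Fin 2 → Fin 2 → ℝ} (hα : ∀ i j, 0 ≤ α i j)
    (h : 0 < totalRate N α) (f : Jump N → E) :
    ∫ m, f m ∂(jumpLaw N α) = ∑ m, (jumpRate N α m / totalRate N α) • f m := by
  have hr : ∀ m : Jump N, 0 ≤ jumpRate N α m / totalRate N α := fun m =>
    div_nonneg (div_nonneg (hα _ _) (Nat.cast_nonneg _)) h.le
  unfold jumpLaw
  rw [integral_finsetSum_measure]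
  · refine Finset.sum_congr rfl fun m _ => ?_
    rw [integral_smul_measure, integral_dirac, ENNReal.toReal_ofReal (hr m)]
  · intro m _
    refine Integrable.smul_measure ?_ ENNReal.ofReal_ne_top
    exact integrable_dirac enorm_lt_top

theorem ae_nonneg_stepLaw {α : Fin 2 → Fin 2 → ℝ} (hα : ∀ i j, 0 ≤ α i j)
    (h : 0 < totalRate N α) : ∀ᵐ p ∂(stepLaw N α), 0 ≤ p.1 := by
  have := isProbabilityMeasure_jumpLaw hα h
  have := isProbabilityMeasure_expMeasure h
  exact Measure.quasiMeasurePreserving_fst.ae (ae_nonneg_expMeasure _)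

theorem stepLaw_real_le {α : Fin 2 → Fin 2 → ℝ} (hα : ∀ i j, 0 ≤ α i j)
    (h : 0 < totalRate N α) {t : ℝ} (ht : 0 ≤ t) :
    (stepLaw N α).real {p | p.1 ≤ t} = 1 - Real.exp (-(totalRate N α * t)) := by
  have := isProbabilityMeasure_jumpLaw hα h
  have := isProbabilityMeasure_expMeasure h
  have : {p : ℝ × Jump N | p.1 ≤ t} = Set.Iic t ×ˢ Set.univ := by ext; simp
  rw [this, stepLaw, measureReal_prod_prod, expMeasure_real_Iic h ht]
  simp

/-- The expectation over one step of an observable that is stopped at time `t` if the holding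
time exceeds `t`. -/
theorem integral_stepLaw_ite {E : Type*} [NormedAddCommGroup E] [NormedSpace ℝ E]
    [CompleteSpace E] {α : Fin 2 → Fin 2 → ℝ} (hα : ∀ i j, 0 ≤ α i j)
    (h : 0 < totalRate N α) {t : ℝ} (ht : 0 ≤ t) {f : ℝ → Jump N → E}
    (hf : ∀ m, Continuous fun s => f s m) (k : E) :
    Integrable (fun p : ℝ × Jump N => if t < p.1 then k else f p.1 p.2) (stepLaw N α) ∧
    ∫ p, (if t < p.1 then k else f p.1 p.2) ∂(stepLaw N α)
      = Real.exp (-(totalRate N α * t)) • k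
        + ∫ s in (0)..t, Real.exp (-(totalRate N α * s)) • ∑ m, jumpRate N α m • f s m := by
  have hj := isProbabilityMeasure_jumpLaw hα h
  have he := isProbabilityMeasure_expMeasure h
  have hp := isProbabilityMeasure_stepLaw N α hα h
  have hint : Integrable (fun p : ℝ × Jump N => if t < p.1 then k else f p.1 p.2)
      (stepLaw N α) := by
    have hsm : StronglyMeasurable fun p : ℝ × Jump N => f p.1 p.2 := by
      exact stronglyMeasurable_uncurry_of_continuous_of_stronglyMeasurable hf
        fun _ => StronglyMeasurable.of_discrete
    choose C hC using fun m => isCompact_Icc.exists_bound_of_continuousOn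
      (f := fun s => f s m) (s := Set.Icc 0 t) (hf m).continuousOn
    refine Integrable.of_bound (StronglyMeasurable.ite (measurableSet_lt measurable_const
      measurable_fst) stronglyMeasurable_const hsm).aestronglyMeasurable
      (‖k‖ + ∑ m, |C m|) ?_
    filter_upwards [ae_nonneg_stepLaw hα h] with p hp0
    have h0 : 0 ≤ ∑ m, |C m| := Finset.sum_nonneg fun m _ => abs_nonneg _
    split_ifs with hlt
    · linarith
    · have h1 := hC p.2 p.1 ⟨hp0, not_lt.1 hlt⟩
      have h2 := Finset.single_le_sum (f := fun m => |C m|) (fun m _ => abs_nonneg _)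
        (Finset.mem_univ p.2)
      have h3 := le_abs_self (C p.2)
      have h4 := norm_nonneg k
      linarith
  refine ⟨hint, ?_⟩
  rw [stepLaw] at hint ⊢
  rw [integral_prod _ hint]
  have hsum : ∀ s : ℝ, ∫ m, (if t < s then k else f s m) ∂(jumpLaw N α)
      = if t < s then k else ∑ m, (jumpRate N α m / totalRate N α) • f s m := by
    intro s
    split_ifs
    · simp
    · exact integral_jumpLaw hα h _
  simp only [hsum]
  rw [integral_expMeasure_ite h ht (by fun_prop)]
  congr 1
  refine intervalIntegral.integral_congr fun s _ => ?_
  simp only [Finset.smul_sum, smul_smul]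
  refine Finset.sum_congr rfl fun m _ => ?_
  congr 1
  field_simp

/-! ### Jump times do not accumulate -/

variable {α : Fin 2 → Fin 2 → ℝ}

theorem noiseLaw_eq (hα : ∀ i j, 0 ≤ α i j) (h : 0 < totalRate N α) :
    haveI := isProbabilityMeasure_stepLaw N α hα h
    noiseLaw N α = Measure.infinitePi fun _ => stepLaw N α := by
  have := isProbabilityMeasure_stepLaw N α hα h
  rw [noiseLaw, dif_pos this]

theorem isProbabilityMeasure_noiseLaw (hα : ∀ i j, 0 ≤ α i j) (h : 0 < totalRate N α) :
    IsProbabilityMeasure (noiseLaw N α) := by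
  have := isProbabilityMeasure_stepLaw N α hα h
  rw [noiseLaw_eq hα h]
  infer_instance

theorem map_prepend_noiseLaw (hα : ∀ i j, 0 ≤ α i j) (h : 0 < totalRate N α) :
    ((stepLaw N α).prod (noiseLaw N α)).map (fun p => prepend p.1 p.2) = noiseLaw N α := by
  have := isProbabilityMeasure_stepLaw N α hα h
  rw [noiseLaw_eq hα h]
  exact map_prepend_infinitePi _

theorem integral_noiseLaw {E : Type*} [NormedAddCommGroup E] [NormedSpace ℝ E]
    (hα : ∀ i j, 0 ≤ α i j) (h : 0 < totalRate N α)
    {f : (ℕ → ℝ × Jump N) → E} (hf : Integrable f (noiseLaw N α)) :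
    Integrable (fun a => ∫ ω, f (prepend a ω) ∂(noiseLaw N α)) (stepLaw N α) ∧
    ∫ ω, f ω ∂(noiseLaw N α) = ∫ a, ∫ ω, f (prepend a ω) ∂(noiseLaw N α) ∂(stepLaw N α) := by
  have := isProbabilityMeasure_stepLaw N α hα h
  rw [noiseLaw_eq hα h] at hf ⊢
  exact integral_infinitePi_eq_integral_prepend _ hf

theorem ae_nonneg_holdingTime (hα : ∀ i j, 0 ≤ α i j) (h : 0 < totalRate N α) :
    ∀ᵐ ω ∂(noiseLaw N α), ∀ k, 0 ≤ (ω k).1 := by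
  have := isProbabilityMeasure_stepLaw N α hα h
  rw [noiseLaw_eq hα h, ae_all_iff]
  intro k
  exact (measurePreserving_eval_infinitePi (fun _ : ℕ => stepLaw N α) k).quasiMeasurePreserving.ae
    (ae_nonneg_stepLaw hα h)

/-- The jump times are a.s. unbounded: if `p` is the probability that all of them are at most `t`,
conditioning on the first one gives `p ≤ (1 - e ^ (-λ t)) p`, where `λ` is the total rate. -/
theorem ae_exists_lt_jumpTime (hα : ∀ i j, 0 ≤ α i j) (h : 0 < totalRate N α) (t : ℝ) :
    ∀ᵐ ω ∂(noiseLaw N α), ∃ n, t < jumpTime N ω (n + 1) := by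
  wlog ht : 0 ≤ t generalizing t
  · filter_upwards [this 0 le_rfl] with ω ⟨n, hn⟩
    exact ⟨n, by linarith⟩
  have hP := isProbabilityMeasure_noiseLaw hα h
  have hS := isProbabilityMeasure_stepLaw N α hα h
  set A : Set (ℕ → ℝ × Jump N) := {ω | ∀ n, jumpTime N ω (n + 1) ≤ t} with hA
  have hAm : MeasurableSet A := by
    simp only [hA, Set.ofPred_forall]
    exact MeasurableSet.iInter fun n => measurableSet_le (measurable_jumpTime _) measurable_const
  have hsub : (fun p : (ℝ × Jump N) × (ℕ → ℝ × Jump N) => prepend p.1 p.2) ⁻¹' A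
      ≤ᵐ[(stepLaw N α).prod (noiseLaw N α)] {p | p.1 ≤ t} ×ˢ A := by
    filter_upwards [Measure.quasiMeasurePreserving_fst.ae (ae_nonneg_stepLaw hα h)] with p hp hpA
    have hpA' : ∀ n, p.1.1 + jumpTime N p.2 n ≤ t := fun n => by
      rw [← jumpTime_prepend]; exact hpA n
    refine ⟨?_, fun n => ?_⟩
    · simpa [jumpTime] using hpA' 0
    · have := hpA' (n + 1)
      linarith
  have hle : (noiseLaw N α).real A
      ≤ (1 - Real.exp (-(totalRate N α * t))) * (noiseLaw N α).real A := by
    rw [← stepLaw_real_le hα h ht, ← measureReal_prod_prod]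
    conv_lhs => rw [← map_prepend_noiseLaw hα h, map_measureReal_apply measurable_prepend hAm]
    exact ENNReal.toReal_mono (measure_ne_top _ _) (measure_mono_ae hsub)
  have h0 : (noiseLaw N α).real A = 0 := by
    have := Real.exp_pos (-(totalRate N α * t))
    have h2 : 0 ≤ (noiseLaw N α).real A := measureReal_nonneg
    nlinarith
  rw [ae_iff]
  simp only [not_exists, not_lt]
  exact (measureReal_eq_zero_iff).1 h0

/-! ### Observables on which the generator acts linearly -/

section Dynkin

variable {E : Type*} [NormedAddCommGroup E]

theorem integrable_process (hα : ∀ i j, 0 ≤ α i j) (h : 0 < totalRate N α) (v : Fin 2 → ℝ)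
    {Φ : Config N → E} (hΦ : Continuous Φ) (x : Config N) {t : ℝ} (ht : 0 ≤ t) :
    Integrable (fun ω => Φ (process N v x t ω)) (noiseLaw N α) := by
  have hP := isProbabilityMeasure_noiseLaw hα h
  obtain ⟨C, hC⟩ := (isCompact_closedBall (0 : Config N)
    (‖x‖ + ‖v‖ * t)).exists_bound_of_continuousOn hΦ.continuousOn
  refine Integrable.of_bound
    (hΦ.comp_stronglyMeasurable (measurable_process v x t).stronglyMeasurable).aestronglyMeasurable
    C ?_
  filter_upwards [ae_nonneg_holdingTime hα h] with ω hω
  exact hC _ (by simpa using norm_process_le v x hω ht)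

variable [NormedSpace ℝ E]

/-- Conditioning on the first step. -/
theorem integral_process_eq_step [CompleteSpace E] (hα : ∀ i j, 0 ≤ α i j)
    (h : 0 < totalRate N α) (v : Fin 2 → ℝ)
    {Φ : Config N → E} (hΦ : Continuous Φ) (x : Config N) {t : ℝ} (ht : 0 ≤ t) :
    Integrable (fun p : ℝ × Jump N => if t < p.1 then Φ (drift N v t x) else
        ∫ ω, Φ (process N v (applyJump N p.2 (drift N v p.1 x)) (t - p.1) ω) ∂(noiseLaw N α))
      (stepLaw N α) ∧
    ∫ ω, Φ (process N v x t ω) ∂(noiseLaw N α)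
      = ∫ p, (if t < p.1 then Φ (drift N v t x) else
          ∫ ω, Φ (process N v (applyJump N p.2 (drift N v p.1 x)) (t - p.1) ω) ∂(noiseLaw N α))
        ∂(stepLaw N α) := by
  have hP := isProbabilityMeasure_noiseLaw hα h
  have hint := integral_noiseLaw hα h (integrable_process hα h v hΦ x ht)
  have heq : (fun p : ℝ × Jump N => ∫ ω, Φ (process N v x t (prepend p ω)) ∂(noiseLaw N α))
      = fun p => if t < p.1 then Φ (drift N v t x) else
        ∫ ω, Φ (process N v (applyJump N p.2 (drift N v p.1 x)) (t - p.1) ω) ∂(noiseLaw N α) := by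
    funext p
    split_ifs with hlt
    · simp [process_prepend_of_lt v x _ hlt]
    · refine integral_congr_ae ?_
      filter_upwards [ae_exists_lt_jumpTime hα h (t - p.1)] with ω hω
      rw [process_prepend_of_le v x (not_lt.1 hlt) hω]
  rw [heq] at hint
  exact hint

/-- The renewal equation solved by `exp (t B)`, where `B` is the generator. It integrates the
derivative of `s ↦ e ^ (-λ s) exp ((t - s) B) Φ (drift s x)`, with `λ` the total rate. -/
theorem exp_smul_generator_eq_step [CompleteSpace E] (v : Fin 2 → ℝ) {Φ : Config N → E}
    (hΦ : Continuous Φ) (B₁ B₂ : E →L[ℝ] E)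
    (hd : ∀ x s, HasDerivAt (fun s => Φ (drift N v s x)) (B₁ (Φ (drift N v s x))) s)
    (hj : ∀ x, ∑ m, jumpRate N α m • (Φ (applyJump N m x) - Φ x) = B₂ (Φ x))
    (x : Config N) (t : ℝ) :
    NormedSpace.exp (t • (B₁ + B₂)) (Φ x)
      = Real.exp (-(totalRate N α * t)) • Φ (drift N v t x)
        + ∫ s in (0)..t, Real.exp (-(totalRate N α * s)) • ∑ m, jumpRate N α m •
            NormedSpace.exp ((t - s) • (B₁ + B₂)) (Φ (applyJump N m (drift N v s x))) := by
  set B := B₁ + B₂ with hB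
  set r := totalRate N α with hr
  have hexp : ∀ s : ℝ, HasDerivAt (fun s : ℝ => NormedSpace.exp ((t - s) • B))
      (-(NormedSpace.exp ((t - s) • B) * B)) s := fun s => by
    have h1 := (hasDerivAt_exp_smul_const (𝕂 := ℝ) B (t - s)).scomp s
      ((hasDerivAt_id s).const_sub t)
    simpa [Function.comp_def] using! h1
  have hcexp : Continuous fun s : ℝ => NormedSpace.exp ((t - s) • B) :=
    continuous_iff_continuousAt.2 fun s => (hexp s).continuousAt
  have hdrift : Continuous fun s : ℝ => drift N v s x :=
    (continuous_drift v).comp (continuous_id.prodMk continuous_const)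
  have hderiv : ∀ s : ℝ, HasDerivAt
      (fun s => Real.exp (-(r * s)) • NormedSpace.exp ((t - s) • B) (Φ (drift N v s x)))
      (-(Real.exp (-(r * s)) • ∑ m, jumpRate N α m •
            NormedSpace.exp ((t - s) • B) (Φ (applyJump N m (drift N v s x))))) s := fun s => by
    have h1 : HasDerivAt (fun s => Real.exp (-(r * s))) (Real.exp (-(r * s)) * -r) s :=
      (((hasDerivAt_id s).const_mul r).neg).exp.congr_deriv (by simp)
    have h2 := h1.smul ((hexp s).clm_apply (hd x s))
    refine h2.congr_deriv ?_
    have h3 : ∑ m, jumpRate N α m •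
        NormedSpace.exp ((t - s) • B) (Φ (applyJump N m (drift N v s x)))
        = NormedSpace.exp ((t - s) • B) (B₂ (Φ (drift N v s x)))
          + r • NormedSpace.exp ((t - s) • B) (Φ (drift N v s x)) := by
      rw [← hj]
      simp only [map_sum, map_smul, map_sub, smul_sub, Finset.sum_sub_distrib, ← Finset.sum_smul]
      rw [hr, totalRate]
      abel
    rw [h3]
    simp only [hB, neg_apply, mul_apply_eq_comp,
      add_apply, map_add, smul_add, smul_neg, smul_smul, mul_neg,
      neg_smul, mul_comm r]
    abel
  have hc : Continuous fun s : ℝ => -(Real.exp (-(r * s)) • ∑ m, jumpRate N α m •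
            NormedSpace.exp ((t - s) • B) (Φ (applyJump N m (drift N v s x)))) := by
    refine (Continuous.smul (by fun_prop) (continuous_finsetSum _ fun m _ => ?_)).neg
    exact (hcexp.clm_apply (hΦ.comp ((continuous_applyJump m).comp hdrift))).const_smul _
  have hFTC := intervalIntegral.integral_eq_sub_of_hasDerivAt (a := 0) (b := t)
    (fun s _ => hderiv s) (hc.intervalIntegrable _ _)
  rw [intervalIntegral.integral_neg] at hFTC
  have h0 : drift N v 0 x = x := by funext p; simp [drift]
  simp only [sub_self, zero_smul, NormedSpace.exp_zero, mul_zero, neg_zero, Real.exp_zero,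
    one_smul, sub_zero, h0, one_apply_eq_self] at hFTC
  rw [← neg_neg (∫ s in (0)..t, _), hFTC]
  abel

/-- **Dynkin's formula** for a vector `Φ` of observables which the drift part and the jump part of
the generator transform linearly, by `B₁` and `B₂`. Both sides satisfy the same renewal equation
on the bounded set of all `(t, x)` with `‖x‖ + ‖v‖ t ≤ ρ`, and one step is a contraction there. -/
theorem integral_process_eq_exp [CompleteSpace E] (hα : ∀ i j, 0 ≤ α i j)
    (h : 0 < totalRate N α) (v : Fin 2 → ℝ) {Φ : Config N → E}
    (hΦ : Continuous Φ) (B₁ B₂ : E →L[ℝ] E)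
    (hd : ∀ x s, HasDerivAt (fun s => Φ (drift N v s x)) (B₁ (Φ (drift N v s x))) s)
    (hj : ∀ x, ∑ m, jumpRate N α m • (Φ (applyJump N m x) - Φ x) = B₂ (Φ x))
    (x₀ : Config N) {T : ℝ} (hT : 0 ≤ T) :
    ∫ ω, Φ (process N v x₀ T ω) ∂(noiseLaw N α) = NormedSpace.exp (T • (B₁ + B₂)) (Φ x₀) := by
  have hP := isProbabilityMeasure_noiseLaw hα h
  have hS := isProbabilityMeasure_stepLaw N α hα h
  set B := B₁ + B₂ with hB
  set r := totalRate N α with hr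
  set ρ := ‖x₀‖ + ‖v‖ * T with hρ
  set q := 1 - Real.exp (-(r * T)) with hq
  have hq0 : 0 ≤ q := sub_nonneg.2 (Real.exp_le_one_iff.2 (by nlinarith))
  have hq1 : q < 1 := by have := Real.exp_pos (-(r * T)); linarith
  have hcexp : Continuous fun s : ℝ => NormedSpace.exp (s • B) :=
    continuous_iff_continuousAt.2 fun s => (hasDerivAt_exp_smul_const (𝕂 := ℝ) B s).continuousAt
  obtain ⟨C, hC⟩ := (isCompact_closedBall (0 : Config N) ρ).exists_bound_of_continuousOn
    hΦ.continuousOn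
  obtain ⟨D, hD⟩ := (isCompact_Icc (a := 0) (b := T)).exists_bound_of_continuousOn
    hcexp.continuousOn
  have key : ∀ n : ℕ, ∀ t x, 0 ≤ t → t ≤ T → ‖x‖ + ‖v‖ * t ≤ ρ →
      ‖∫ ω, Φ (process N v x t ω) ∂(noiseLaw N α) - NormedSpace.exp (t • B) (Φ x)‖
        ≤ q ^ n * (C + D * C) := by
    intro n
    induction n with
    | zero =>
      intro t x ht htT hx
      have hxρ : ‖x‖ ≤ ρ := by have := mul_nonneg (norm_nonneg v) ht; linarith
      have hΦx := hC x (by simpa using hxρ)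
      have hexpt := hD t ⟨ht, htT⟩
      rw [pow_zero, one_mul]
      refine (norm_sub_le _ _).trans (add_le_add ?_ ?_)
      · have := norm_integral_le_of_norm_le_const (μ := noiseLaw N α)
          (f := fun ω => Φ (process N v x t ω)) (C := C) (by
            filter_upwards [ae_nonneg_holdingTime hα h] with ω hω
            exact hC _ (by simpa using (norm_process_le v x hω ht).trans hx))
        simpa using this
      · exact (ContinuousLinearMap.le_opNorm _ _).trans
          (mul_le_mul hexpt hΦx (norm_nonneg _) ((norm_nonneg _).trans hexpt))
    | succ n ih =>
      intro t x ht htT hx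
      set M := q ^ n * (C + D * C) with hM
      have hM0 : 0 ≤ M := (norm_nonneg _).trans (ih t x ht htT hx)
      obtain ⟨hi1, he1⟩ := integral_process_eq_step hα h v hΦ x ht
      obtain ⟨hi2, he2⟩ := integral_stepLaw_ite hα h ht
        (f := fun s m => NormedSpace.exp ((t - s) • B) (Φ (applyJump N m (drift N v s x))))
        (fun m => (hcexp.comp (continuous_const.sub continuous_id)).clm_apply
          (hΦ.comp ((continuous_applyJump m).comp
            ((continuous_drift v).comp (continuous_id.prodMk continuous_const)))))
        (Φ (drift N v t x))
      rw [← exp_smul_generator_eq_step v hΦ B₁ B₂ hd hj x t] at he2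
      rw [he1, ← he2, ← integral_sub hi1 hi2]
      have hm : MeasurableSet {p : ℝ × Jump N | p.1 ≤ t} :=
        measurableSet_le measurable_fst measurable_const
      calc _ ≤ ∫ p, Set.indicator {p : ℝ × Jump N | p.1 ≤ t} (fun _ => M) p ∂(stepLaw N α) := by
            refine norm_integral_le_of_norm_le ((integrable_const _).indicator hm) ?_
            filter_upwards [ae_nonneg_stepLaw hα h] with p hp
            by_cases hpt : t < p.1
            · rw [if_pos hpt, if_pos hpt, sub_self, norm_zero]
              exact Set.indicator_nonneg (fun _ _ => hM0) _
            · rw [if_neg hpt, if_neg hpt,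
                Set.indicator_of_mem (show p ∈ {p : ℝ × Jump N | p.1 ≤ t} from not_lt.1 hpt)]
              refine ih _ _ (by linarith) (by linarith) ?_
              have h1 := norm_applyJump_le p.2 (drift N v p.1 x)
              have h2 := norm_drift_le v hp x
              linarith
        _ = (1 - Real.exp (-(r * t))) * M := by
            rw [integral_indicator hm, setIntegral_const, stepLaw_real_le hα h ht, smul_eq_mul]
        _ ≤ q * M := by
            refine mul_le_mul_of_nonneg_right ?_ hM0
            have : Real.exp (-(r * T)) ≤ Real.exp (-(r * t)) := Real.exp_le_exp.2 (by nlinarith)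
            linarith
        _ = q ^ (n + 1) * (C + D * C) := by rw [hM]; ring
  have hlim : Tendsto (fun n : ℕ => q ^ n * (C + D * C)) atTop (𝓝 0) := by
    simpa using (tendsto_pow_atTop_nhds_zero_of_lt_one hq0 hq1).mul_const (C + D * C)
  have := ge_of_tendsto' hlim fun n => key n T x₀ hT le_rfl le_rfl
  exact sub_eq_zero.1 (norm_le_zero_iff.1 this)

end Dynkin

/-! ### The generator on empirical means and variances -/

/-- The empirical mean square of type `i`. -/
noncomputable def empSq (N : Fin 2 → ℕ) (i : Fin 2) (x : Config N) : ℝ :=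
  (1 / (N i : ℝ)) * ∑ k : Fin (N i), x ⟨i, k⟩ ^ 2

theorem empVar_eq {i : Fin 2} (hN : 0 < N i) (x : Config N) :
    empVar N i x = empSq N i x - empMean N i x ^ 2 := by
  have hN' : (N i : ℝ) ≠ 0 := by positivity
  have h1 : ∑ k : Fin (N i), x ⟨i, k⟩ = N i * empMean N i x := by
    unfold empMean; field_simp
  unfold empVar empSq
  simp only [sub_sq, Finset.sum_add_distrib, Finset.sum_sub_distrib, Finset.sum_const,
    ← Finset.sum_mul, ← Finset.mul_sum, h1, Finset.card_univ, Fintype.card_fin, nsmul_eq_mul]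
  field_simp
  ring

theorem empVar_nonneg (i : Fin 2) (x : Config N) : 0 ≤ empVar N i x := by
  unfold empVar; positivity

/-- Replacing `y i` by `z` changes the sum of `f ∘ y` by `f z - f (y i)`. -/
theorem sum_applyJump (f : ℝ → ℝ) (i : Fin 2) (k : Fin (N i)) (q : Particle N) (x : Config N) :
    ∑ l : Fin (N i), f (applyJump N (⟨i, k⟩, q) x ⟨i, l⟩)
      = ∑ l : Fin (N i), f (x ⟨i, l⟩) + (f (x q) - f (x ⟨i, k⟩)) := by
  rw [← sub_eq_iff_eq_add', ← Finset.sum_sub_distrib, Finset.sum_eq_single k]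
  · simp [applyJump]
  · intro l _ hl
    have : (⟨i, l⟩ : Particle N) ≠ ⟨i, k⟩ := by simpa using hl
    simp [applyJump, Function.update_of_ne this]
  · simp

theorem applyJump_apply_of_ne {i j : Fin 2} (hij : j ≠ i) (k : Fin (N i)) (q : Particle N)
    (x : Config N) (l : Fin (N j)) : applyJump N (⟨i, k⟩, q) x ⟨j, l⟩ = x ⟨j, l⟩ := by
  have : (⟨j, l⟩ : Particle N) ≠ ⟨i, k⟩ := fun h => hij (congrArg Sigma.fst h)
  simp [applyJump, Function.update_of_ne this]

theorem empMean_applyJump {i : Fin 2} (k : Fin (N i)) (q : Particle N) (x : Config N) :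
    empMean N i (applyJump N (⟨i, k⟩, q) x) = empMean N i x + (x q - x ⟨i, k⟩) / N i := by
  unfold empMean
  rw [sum_applyJump (fun y => y)]
  ring

theorem empSq_applyJump {i : Fin 2} (k : Fin (N i)) (q : Particle N) (x : Config N) :
    empSq N i (applyJump N (⟨i, k⟩, q) x) = empSq N i x + (x q ^ 2 - x ⟨i, k⟩ ^ 2) / N i := by
  unfold empSq
  rw [sum_applyJump (fun y => y ^ 2)]
  ring

theorem empMean_applyJump_of_ne {i j : Fin 2} (hij : j ≠ i) (k : Fin (N i)) (q : Particle N)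
    (x : Config N) : empMean N j (applyJump N (⟨i, k⟩, q) x) = empMean N j x := by
  simp only [empMean, applyJump_apply_of_ne hij]

theorem empVar_applyJump_of_ne {i j : Fin 2} (hij : j ≠ i) (k : Fin (N i)) (q : Particle N)
    (x : Config N) : empVar N j (applyJump N (⟨i, k⟩, q) x) = empVar N j x := by
  simp only [empVar, empMean_applyJump_of_ne hij, applyJump_apply_of_ne hij]

theorem empVar_applyJump {i : Fin 2} (hN : 0 < N i) (k : Fin (N i)) (q : Particle N)
    (x : Config N) : empVar N i (applyJump N (⟨i, k⟩, q) x)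
      = empVar N i x + (x q ^ 2 - x ⟨i, k⟩ ^ 2) / N i
        - 2 * empMean N i x * ((x q - x ⟨i, k⟩) / N i) - ((x q - x ⟨i, k⟩) / N i) ^ 2 := by
  rw [empVar_eq hN, empVar_eq hN, empSq_applyJump, empMean_applyJump]
  ring

/-- The double sum of a quadratic polynomial in terms of empirical means and mean squares. -/
theorem sum_sum_quadratic {i j : Fin 2} (hi : 0 < N i) (hj : 0 < N j) (x : Config N)
    (a₁ a₂ a₃ a₄ a₅ : ℝ) :
    ∑ k : Fin (N i), ∑ l : Fin (N j), (a₁ * x ⟨j, l⟩ ^ 2 + a₂ * x ⟨j, l⟩ + a₃ * x ⟨i, k⟩ ^ 2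
        + a₄ * x ⟨i, k⟩ + a₅ * (x ⟨i, k⟩ * x ⟨j, l⟩))
      = N i * N j * (a₁ * empSq N j x + a₂ * empMean N j x + a₃ * empSq N i x
        + a₄ * empMean N i x + a₅ * (empMean N i x * empMean N j x)) := by
  have hi' : (N i : ℝ) ≠ 0 := by positivity
  have hj' : (N j : ℝ) ≠ 0 := by positivity
  simp only [Finset.sum_add_distrib, Finset.sum_const, ← Finset.mul_sum, ← Finset.sum_mul,
    Finset.card_univ, Fintype.card_fin, nsmul_eq_mul]
  unfold empMean empSq
  field_simp

/-- The sum over all jumps, with their rates, when there are no jumps within a type. -/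
theorem sum_jumpRate_mul {α : Fin 2 → Fin 2 → ℝ} (h00 : α 0 0 = 0) (h11 : α 1 1 = 0)
    (f : Jump N → ℝ) :
    ∑ m, jumpRate N α m * f m
      = α 0 1 / N 1 * ∑ k : Fin (N 0), ∑ l : Fin (N 1), f (⟨0, k⟩, ⟨1, l⟩)
        + α 1 0 / N 0 * ∑ k : Fin (N 1), ∑ l : Fin (N 0), f (⟨1, k⟩, ⟨0, l⟩) := by
  simp only [Fintype.sum_prod_type, Fintype.sum_sigma, Fin.sum_univ_two, jumpRate, h00, h11,
    zero_div, zero_mul, Finset.sum_const_zero, zero_add, add_zero, Finset.mul_sum]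

theorem totalRate_pos {α : Fin 2 → Fin 2 → ℝ} (h00 : α 0 0 = 0) (h11 : α 1 1 = 0)
    (h01 : 0 < α 0 1) (h10 : 0 < α 1 0) (hN : ∀ i, 0 < N i) : 0 < totalRate N α := by
  have := sum_jumpRate_mul (N := N) h00 h11 (fun _ => 1)
  simp only [mul_one] at this
  rw [totalRate, this]
  have h0 : (0 : ℝ) < N 0 := by exact_mod_cast hN 0
  have h1 : (0 : ℝ) < N 1 := by exact_mod_cast hN 1
  simp only [Finset.sum_const, Finset.card_univ, Fintype.card_fin, nsmul_eq_mul, mul_one]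
  positivity

/-- The observables `1, D, D², S₁², S₂²`, where `D` is the signed distance of the two mass centres
and `Sᵢ²` are the empirical variances. Their span is invariant under the generator; the constant
makes the inhomogeneous moment equations linear. -/
noncomputable def moments (N : Fin 2 → ℕ) (x : Config N) : Fin 5 → ℝ :=
  ![1, empMean N 0 x - empMean N 1 x, (empMean N 0 x - empMean N 1 x) ^ 2,
    empVar N 0 x, empVar N 1 x]

theorem continuous_moments : Continuous (moments N) := by
  refine continuous_pi fun k => ?_
  fin_cases k <;> simp [moments, empMean, empVar] <;> fun_prop

/-- The drift part of the generator on `moments`. -/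
noncomputable def driftMatrix (v : Fin 2 → ℝ) : Matrix (Fin 5) (Fin 5) ℝ :=
  !![0, 0, 0, 0, 0;
     v 0 - v 1, 0, 0, 0, 0;
     0, 2 * (v 0 - v 1), 0, 0, 0;
     0, 0, 0, 0, 0;
     0, 0, 0, 0, 0]

/-- The jump part of the generator on `moments`. -/
noncomputable def jumpMatrix (N : Fin 2 → ℕ) (α : Fin 2 → Fin 2 → ℝ) : Matrix (Fin 5) (Fin 5) ℝ :=
  !![0, 0, 0, 0, 0;
     0, -(α 0 1 + α 1 0), 0, 0, 0;
     0, 0, -2 * (α 0 1 + α 1 0) + (α 0 1 / N 0 + α 1 0 / N 1), α 0 1 / N 0 + α 1 0 / N 1,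
       α 0 1 / N 0 + α 1 0 / N 1;
     0, 0, α 0 1 - α 0 1 / N 0, -α 0 1 - α 0 1 / N 0, α 0 1 - α 0 1 / N 0;
     0, 0, α 1 0 - α 1 0 / N 1, α 1 0 - α 1 0 / N 1, -α 1 0 - α 1 0 / N 1]

theorem empMean_drift (v : Fin 2 → ℝ) {i : Fin 2} (hN : 0 < N i) (s : ℝ) (x : Config N) :
    empMean N i (drift N v s x) = empMean N i x + v i * s := by
  have hN' : (N i : ℝ) ≠ 0 := by positivity
  simp only [empMean, drift, Finset.sum_add_distrib, Finset.sum_const, Finset.card_univ,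
    Fintype.card_fin, nsmul_eq_mul]
  field_simp

theorem empVar_drift (v : Fin 2 → ℝ) {i : Fin 2} (hN : 0 < N i) (s : ℝ) (x : Config N) :
    empVar N i (drift N v s x) = empVar N i x := by
  simp only [empVar, empMean_drift v hN, drift, add_sub_add_right_eq_sub]

theorem hasDerivAt_moments_drift (v : Fin 2 → ℝ) (hN : ∀ i, 0 < N i) (x : Config N) (s : ℝ) :
    HasDerivAt (fun s => moments N (drift N v s x))
      ((driftMatrix v).mulVec (moments N (drift N v s x))) s := by
  have hD : HasDerivAt (fun s => empMean N 0 x + v 0 * s - (empMean N 1 x + v 1 * s))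
      (v 0 - v 1) s := by
    have := (((hasDerivAt_id s).const_mul (v 0)).const_add (empMean N 0 x)).sub
      (((hasDerivAt_id s).const_mul (v 1)).const_add (empMean N 1 x))
    simpa using! this
  refine hasDerivAt_pi.2 fun k => ?_
  fin_cases k
  · simpa [moments, driftMatrix, Matrix.mulVec, dotProduct, Fin.sum_univ_succ]
      using! hasDerivAt_const s (1 : ℝ)
  · simpa [moments, driftMatrix, Matrix.mulVec, dotProduct, Fin.sum_univ_succ,
      empMean_drift v (hN _)]
      using! hD
  · have := hD.pow 2
    simp [moments, driftMatrix, Matrix.mulVec, dotProduct, Fin.sum_univ_succ,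
      empMean_drift v (hN _)]
    refine this.congr_deriv ?_
    simp; ring
  · simpa [moments, driftMatrix, Matrix.mulVec, dotProduct, Fin.sum_univ_succ,
      empVar_drift v (hN _)]
      using! hasDerivAt_const s (empVar N 0 x)
  · simpa [moments, driftMatrix, Matrix.mulVec, dotProduct, Fin.sum_univ_succ,
      empVar_drift v (hN _)]
      using! hasDerivAt_const s (empVar N 1 x)

theorem sum_jumpRate_smul_moments {α : Fin 2 → Fin 2 → ℝ} (h00 : α 0 0 = 0) (h11 : α 1 1 = 0)
    (hN : ∀ i, 0 < N i) (x : Config N) :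
    ∑ m, jumpRate N α m • (moments N (applyJump N m x) - moments N x)
      = (jumpMatrix N α).mulVec (moments N x) := by
  have h0 : (N 0 : ℝ) ≠ 0 := by exact_mod_cast (hN 0).ne'
  have h1 : (N 1 : ℝ) ≠ 0 := by exact_mod_cast (hN 1).ne'
  have q0 := sum_sum_quadratic (hN 0) (hN 1) x
  have q1 := sum_sum_quadratic (hN 1) (hN 0) x
  have e01 : (1 : Fin 2) ≠ 0 := by decide
  have e10 : (0 : Fin 2) ≠ 1 := by decide
  have hm0 := fun k q => empMean_applyJump (i := 0) k q x
  have hm1 := fun k q => empMean_applyJump (i := 1) k q x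
  have hv0 := fun k q => empVar_applyJump (hN 0) k q x
  have hv1 := fun k q => empVar_applyJump (hN 1) k q x
  funext i
  simp only [Finset.sum_apply, Pi.smul_apply, Pi.sub_apply, smul_eq_mul]
  rw [sum_jumpRate_mul h00 h11]
  -- the increment of each observable is a quadratic polynomial in the two coordinates involved
  match i with
  | 0 => simp [moments, jumpMatrix, Matrix.mulVec, dotProduct, Fin.sum_univ_succ]
  | 1 =>
    have p0 : ∀ k l, moments N (applyJump N (⟨0, k⟩, ⟨1, l⟩) x) 1 - moments N x 1
        = 0 * x ⟨1, l⟩ ^ 2 + (1 / N 0) * x ⟨1, l⟩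
          + 0 * x ⟨0, k⟩ ^ 2 + (-1 / N 0) * x ⟨0, k⟩ + 0 * (x ⟨0, k⟩ * x ⟨1, l⟩) := fun k l => by
      simp [moments, hm0, empMean_applyJump_of_ne e01]; ring
    have p1 : ∀ k l, moments N (applyJump N (⟨1, k⟩, ⟨0, l⟩) x) 1 - moments N x 1
        = 0 * x ⟨0, l⟩ ^ 2 + (-1 / N 1) * x ⟨0, l⟩
          + 0 * x ⟨1, k⟩ ^ 2 + (1 / N 1) * x ⟨1, k⟩ + 0 * (x ⟨1, k⟩ * x ⟨0, l⟩) := fun k l => by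
      simp [moments, hm1, empMean_applyJump_of_ne e10]; ring
    simp only [p0, p1, q0, q1]
    simp [moments, jumpMatrix, Matrix.mulVec, dotProduct, Fin.sum_univ_succ, empVar_eq (hN _)]
    field_simp
    ring
  | 2 =>
    have p0 : ∀ k l, moments N (applyJump N (⟨0, k⟩, ⟨1, l⟩) x) 2 - moments N x 2
        = 1 / N 0 ^ 2 * x ⟨1, l⟩ ^ 2 + (2 * (empMean N 0 x - empMean N 1 x) / N 0) * x ⟨1, l⟩
          + 1 / N 0 ^ 2 * x ⟨0, k⟩ ^ 2 + (-2 * (empMean N 0 x - empMean N 1 x) / N 0) * x ⟨0, k⟩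
          + (-2 / N 0 ^ 2) * (x ⟨0, k⟩ * x ⟨1, l⟩) := fun k l => by
      simp [moments, hm0, empMean_applyJump_of_ne e01]; ring
    have p1 : ∀ k l, moments N (applyJump N (⟨1, k⟩, ⟨0, l⟩) x) 2 - moments N x 2
        = 1 / N 1 ^ 2 * x ⟨0, l⟩ ^ 2 + (-2 * (empMean N 0 x - empMean N 1 x) / N 1) * x ⟨0, l⟩
          + 1 / N 1 ^ 2 * x ⟨1, k⟩ ^ 2 + (2 * (empMean N 0 x - empMean N 1 x) / N 1) * x ⟨1, k⟩
          + (-2 / N 1 ^ 2) * (x ⟨1, k⟩ * x ⟨0, l⟩) := fun k l => by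
      simp [moments, hm1, empMean_applyJump_of_ne e10]; ring
    simp only [p0, p1, q0, q1]
    simp [moments, jumpMatrix, Matrix.mulVec, dotProduct, Fin.sum_univ_succ, empVar_eq (hN _)]
    field_simp
    ring
  | 3 =>
    have p0 : ∀ k l, moments N (applyJump N (⟨0, k⟩, ⟨1, l⟩) x) 3 - moments N x 3
        = (1 / N 0 - 1 / N 0 ^ 2) * x ⟨1, l⟩ ^ 2 + (-2 * empMean N 0 x / N 0) * x ⟨1, l⟩
          + (-1 / N 0 - 1 / N 0 ^ 2) * x ⟨0, k⟩ ^ 2 + (2 * empMean N 0 x / N 0) * x ⟨0, k⟩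
          + (2 / N 0 ^ 2) * (x ⟨0, k⟩ * x ⟨1, l⟩) := fun k l => by
      simp [moments, hv0]; ring
    have p1 : ∀ k l, moments N (applyJump N (⟨1, k⟩, ⟨0, l⟩) x) 3 - moments N x 3 = 0 :=
      fun k l => by simp [moments, empVar_applyJump_of_ne e10]
    simp only [p0, p1, q0]
    simp [moments, jumpMatrix, Matrix.mulVec, dotProduct, Fin.sum_univ_succ, empVar_eq (hN _)]
    field_simp
    ring
  | 4 =>
    have p0 : ∀ k l, moments N (applyJump N (⟨0, k⟩, ⟨1, l⟩) x) 4 - moments N x 4 = 0 :=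
      fun k l => by simp [moments, empVar_applyJump_of_ne e01]
    have p1 : ∀ k l, moments N (applyJump N (⟨1, k⟩, ⟨0, l⟩) x) 4 - moments N x 4
        = (1 / N 1 - 1 / N 1 ^ 2) * x ⟨0, l⟩ ^ 2 + (-2 * empMean N 1 x / N 1) * x ⟨0, l⟩
          + (-1 / N 1 - 1 / N 1 ^ 2) * x ⟨1, k⟩ ^ 2 + (2 * empMean N 1 x / N 1) * x ⟨1, k⟩
          + (2 / N 1 ^ 2) * (x ⟨1, k⟩ * x ⟨0, l⟩) := fun k l => by
      simp [moments, hv1]; ring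
    simp only [p0, p1, q1]
    simp [moments, jumpMatrix, Matrix.mulVec, dotProduct, Fin.sum_univ_succ, empVar_eq (hN _)]
    field_simp
    ring

/-! ### The moment equations -/

/-- The linear system satisfied by `d = E D`, `u = E D²`, `r = E S₁²` and `s = E S₂²`, where `D` is
the signed distance of the two mass centres. The parameters are the rates `a = α₁₂`, `b = α₂₁`, the
relative velocity `w` and `p = 1 / N₁`, `q = 1 / N₂`; the initial values are bounded by `C`. -/
structure IsMomentSolution (a b w C p q : ℝ) (d u r s : ℝ → ℝ) : Prop where
  p_pos : 0 < p
  p_le_one : p ≤ 1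
  q_pos : 0 < q
  q_le_one : q ≤ 1
  deriv_d : ∀ t, HasDerivAt d (w - (a + b) * d t) t
  deriv_u : ∀ t, HasDerivAt u
    (2 * w * d t - 2 * (a + b) * u t + (a * p + b * q) * (r t + s t + u t)) t
  deriv_r : ∀ t, HasDerivAt r (a * (s t - r t + u t) - a * p * (r t + s t + u t)) t
  deriv_s : ∀ t, HasDerivAt s (b * (r t - s t + u t) - b * q * (r t + s t + u t)) t
  u_nonneg : ∀ t, 0 ≤ t → 0 ≤ u t
  r_nonneg : ∀ t, 0 ≤ t → 0 ≤ r t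
  s_nonneg : ∀ t, 0 ≤ t → 0 ≤ s t
  abs_d_zero_le : |d 0| ≤ C
  u_zero_le : u 0 ≤ C ^ 2
  r_zero_le : r 0 ≤ C
  s_zero_le : s 0 ≤ C

theorem exists_isMomentSolution (h00 : α 0 0 = 0) (h11 : α 1 1 = 0) (h01 : 0 < α 0 1)
    (h10 : 0 < α 1 0) (hN : ∀ i, 0 < N i) (v : Fin 2 → ℝ) (x : Config N) {C : ℝ}
    (hS : ∀ i, empVar N i x ≤ C) (hl : |empMean N 0 x - empMean N 1 x| ≤ C) :
    ∃ d u r s : ℝ → ℝ,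
      IsMomentSolution (α 0 1) (α 1 0) (v 0 - v 1) C (1 / N 0) (1 / N 1) d u r s ∧
      (∀ t, 0 ≤ t → R N v α x 0 t = r t) ∧ ∀ t, 0 ≤ t → R N v α x 1 t = s t := by
  have hα : ∀ i j, 0 ≤ α i j := by
    intro i j
    fin_cases i <;> fin_cases j
    exacts [h00.ge, h01.le, h10.le, h11.ge]
  have hr := totalRate_pos h00 h11 h01 h10 hN
  set B₁ : (Fin 5 → ℝ) →L[ℝ] (Fin 5 → ℝ) := (driftMatrix v).mulVecLin.toContinuousLinearMap
  set B₂ : (Fin 5 → ℝ) →L[ℝ] (Fin 5 → ℝ) := (jumpMatrix N α).mulVecLin.toContinuousLinearMap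
  set y : ℝ → Fin 5 → ℝ := fun t => NormedSpace.exp (t • (B₁ + B₂)) (moments N x) with hy
  have hmean : ∀ k t, 0 ≤ t →
      ∫ ω, moments N (process N v x t ω) k ∂(noiseLaw N α) = y t k := by
    intro k t ht
    have h1 := integral_process_eq_exp hα hr v continuous_moments B₁ B₂
      (fun x s => hasDerivAt_moments_drift v hN x s)
      (fun x => sum_jumpRate_smul_moments h00 h11 hN x) x ht
    have h2 := (ContinuousLinearMap.proj (R := ℝ) (φ := fun _ : Fin 5 => ℝ) k).integral_comp_comm
      (integrable_process hα hr v continuous_moments x ht)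
    simp only [ContinuousLinearMap.proj_apply] at h2
    rw [h2, h1]
  have hy0 : y 0 = moments N x := by simp [hy]
  have hderiv : ∀ t k, HasDerivAt (fun t => y t k)
      (((driftMatrix v).mulVec (y t) + (jumpMatrix N α).mulVec (y t)) k) t := by
    intro t
    refine hasDerivAt_pi.1 ?_
    have := (hasDerivAt_exp_smul_const' (𝕂 := ℝ) (B₁ + B₂) t).clm_apply
      (hasDerivAt_const t (moments N x))
    refine (show HasDerivAt y _ t from this).congr_deriv ?_
    simp [B₁, B₂, hy]
  have hone : ∀ t, y t 0 = 1 := by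
    have hd : ∀ t, HasDerivAt (fun t => y t 0) 0 t := fun t => by
      simpa [driftMatrix, jumpMatrix, Matrix.mulVec, dotProduct, Fin.sum_univ_succ]
        using! hderiv t 0
    intro t
    have := is_const_of_deriv_eq_zero (fun t => (hd t).differentiableAt) (fun t => (hd t).deriv)
      t 0
    simpa [hy0, moments] using this
  have hNi : ∀ i, (1 : ℝ) ≤ N i := fun i => by exact_mod_cast hN i
  refine ⟨fun t => y t 1, fun t => y t 2, fun t => y t 3, fun t => y t 4,
    ⟨?_, ?_, ?_, ?_, fun t => ?_, fun t => ?_, fun t => ?_, fun t => ?_, fun t ht => ?_,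
      fun t ht => ?_, fun t ht => ?_, ?_, ?_, ?_, ?_⟩, fun t ht => ?_, fun t ht => ?_⟩
  · have := hNi 0; positivity
  · exact (div_le_one (by linarith [hNi 0])).2 (hNi 0)
  · have := hNi 1; positivity
  · exact (div_le_one (by linarith [hNi 1])).2 (hNi 1)
  · refine (hderiv t 1).congr_deriv ?_
    simp [driftMatrix, jumpMatrix, dotProduct, Fin.sum_univ_succ, hone]
    ring
  · refine (hderiv t 2).congr_deriv ?_
    simp [driftMatrix, jumpMatrix, dotProduct, Fin.sum_univ_succ]
    ring
  · refine (hderiv t 3).congr_deriv ?_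
    simp [driftMatrix, jumpMatrix, dotProduct, Fin.sum_univ_succ]
    ring
  · refine (hderiv t 4).congr_deriv ?_
    simp [driftMatrix, jumpMatrix, dotProduct, Fin.sum_univ_succ]
    ring
  · rw [← hmean 2 t ht]
    exact integral_nonneg fun ω => sq_nonneg _
  · rw [← hmean 3 t ht]
    exact integral_nonneg fun ω => empVar_nonneg 0 _
  · rw [← hmean 4 t ht]
    exact integral_nonneg fun ω => empVar_nonneg 1 _
  · rw [hy0]; exact hl
  · rw [hy0]; exact sq_le_sq' (abs_le.1 hl).1 (abs_le.1 hl).2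
  · rw [hy0]; exact hS 0
  · rw [hy0]; exact hS 1
  · exact hmean 3 t ht
  · exact hmean 4 t ht

/-! ### Bounds for the moment equations, uniform in the numbers of particles and in time -/

/-- A function that relaxes at rate `ν` towards values below `M` stays below `M`. -/
theorem le_of_deriv_le {f f' : ℝ → ℝ} {ν M : ℝ} (hf : ∀ t, HasDerivAt f (f' t) t)
    (h0 : f 0 ≤ M) (h : ∀ t, 0 ≤ t → f' t ≤ ν * (M - f t)) {t : ℝ} (ht : 0 ≤ t) : f t ≤ M := by
  have hd : ∀ t, HasDerivAt (fun t => Real.exp (ν * t) * (f t - M))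
      (Real.exp (ν * t) * (f' t - ν * (M - f t))) t := fun t => by
    have h1 : HasDerivAt (fun t => Real.exp (ν * t)) (Real.exp (ν * t) * (ν * 1)) t :=
      ((hasDerivAt_id t).const_mul ν).exp
    refine (h1.mul ((hf t).sub_const M)).congr_deriv ?_
    ring
  have hanti : AntitoneOn (fun t => Real.exp (ν * t) * (f t - M)) (Set.Ici 0) := by
    refine antitoneOn_of_deriv_nonpos (convex_Ici 0)
      (fun t _ => (hd t).continuousAt.continuousWithinAt)
      (fun t _ => (hd t).differentiableAt.differentiableWithinAt) fun t ht => ?_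
    rw [interior_Ici] at ht
    rw [(hd t).deriv]
    exact mul_nonpos_of_nonneg_of_nonpos (Real.exp_pos _).le (by linarith [h t (le_of_lt ht)])
  have h1 := hanti (Set.mem_Ici.2 le_rfl) (Set.mem_Ici.2 ht) ht
  simp only [mul_zero, Real.exp_zero, one_mul] at h1
  have h2 : Real.exp (ν * t) * (f t - M) ≤ 0 := by linarith
  have := nonpos_of_mul_nonpos_right h2 (Real.exp_pos _)
  linarith

theorem abs_le_of_abs_deriv_add_le {f f' : ℝ → ℝ} {ν M : ℝ} (hf : ∀ t, HasDerivAt f (f' t) t)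
    (h0 : |f 0| ≤ M) (h : ∀ t, 0 ≤ t → |f' t + ν * f t| ≤ ν * M) {t : ℝ} (ht : 0 ≤ t) :
    |f t| ≤ M := by
  refine abs_le.2 ⟨?_, ?_⟩
  · have := le_of_deriv_le (f := fun t => -f t) (ν := ν) (M := M) (fun t => (hf t).neg)
      (by linarith [(abs_le.1 h0).1]) (fun t ht => by linarith [(abs_le.1 (h t ht)).1]) ht
    linarith
  · exact le_of_deriv_le (ν := ν) hf (abs_le.1 h0).2
      (fun t ht => by linarith [(abs_le.1 (h t ht)).2]) ht

namespace IsMomentSolution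

variable {a b w C : ℝ}

theorem exists_abs_d_le (ha : 0 < a) (hb : 0 < b) (w C : ℝ) :
    ∃ K, ∀ p q d u r s, IsMomentSolution a b w C p q d u r s → ∀ t, 0 ≤ t → |d t| ≤ K := by
  refine ⟨C + |w| / (a + b), fun p q d u r s h t ht => ?_⟩
  refine abs_le_of_abs_deriv_add_le (ν := a + b) h.deriv_d ?_ (fun t ht => ?_) ht
  · have : 0 ≤ |w| / (a + b) := by positivity
    linarith [h.abs_d_zero_le]
  · have h1 : w - (a + b) * d t + (a + b) * d t = w := by ring
    have h2 : (a + b) * (C + |w| / (a + b)) = (a + b) * C + |w| := by field_simp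
    have hC : 0 ≤ C := (abs_nonneg _).trans h.abs_d_zero_le
    rw [h1, h2]
    have : 0 ≤ (a + b) * C := by positivity
    linarith

/-- The slow variable. In `b r + a s` the exchange of variance between the two types cancels,
and the multiples of `u` and of `d` compensate the production of variance by the distance of the
mass centres, up to its stationary value. -/
noncomputable def slow (a b w : ℝ) (d u r s : ℝ → ℝ) (t : ℝ) : ℝ :=
  b * r t + a * s t + a * b / (a + b) * u t + 2 * a * b * w / (a + b) ^ 2 * d t

theorem hasDerivAt_slow {p q : ℝ} {d u r s : ℝ → ℝ} (ha : 0 < a) (hb : 0 < b)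
    (h : IsMomentSolution a b w C p q d u r s) (t : ℝ) :
    HasDerivAt (slow a b w d u r s) (2 * a * b * w ^ 2 / (a + b) ^ 2
      - a * b / (a + b) * (b * p + a * q) * (r t + s t + u t)) t := by
  -- `(a + b) (p + q) - (a p + b q) = b p + a q` gives the coefficient of `r + s + u`
  refine (((((h.deriv_r t).const_mul b).add ((h.deriv_s t).const_mul a)).add
    ((h.deriv_u t).const_mul (a * b / (a + b)))).add
    ((h.deriv_d t).const_mul (2 * a * b * w / (a + b) ^ 2))).congr_deriv ?_
  have : a + b ≠ 0 := by positivity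
  field_simp
  ring

/-- The total of the second moments is at most of the order of the number of particles. -/
theorem exists_mul_sum_le (ha : 0 < a) (hb : 0 < b) (w C : ℝ) :
    ∃ K, ∀ p q d u r s, IsMomentSolution a b w C p q d u r s →
      ∀ t, 0 ≤ t → (b * p + a * q) * (r t + s t + u t) ≤ K := by
  obtain ⟨D, hD⟩ := exists_abs_d_le ha hb w C
  set e := |2 * a * b * w / (a + b) ^ 2| * D with he
  set θ := 2 * a * b * w ^ 2 / (a + b) ^ 2 with hθ
  set M := (a + b) * C + a * b / (a + b) * C ^ 2 + e with hM
  set L := 2 * (a + b) ^ 2 / (a * b) with hL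
  refine ⟨2 * (a + b) / (a * b) * ((a + b) * (M + 2 * e) + θ * L), fun p q d u r s h => ?_⟩
  set μ := b * p + a * q with hμ
  have hp := h.p_pos
  have hq := h.q_pos
  have hμ0 : 0 < μ := by positivity
  have hμ1 : μ ≤ a + b := by nlinarith [h.p_le_one, h.q_le_one]
  have hC : 0 ≤ C := (abs_nonneg _).trans h.abs_d_zero_le
  have hD0 : 0 ≤ D := (abs_nonneg _).trans (hD p q d u r s h 0 le_rfl)
  have he0 : 0 ≤ e := by positivity
  have hθ0 : 0 ≤ θ := by positivity
  have hL0 : 0 < L := by positivity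
  have hM0 : 0 ≤ M := by positivity
  have hde : ∀ t, 0 ≤ t → |2 * a * b * w / (a + b) ^ 2 * d t| ≤ e := fun t ht => by
    rw [abs_mul]
    exact mul_le_mul_of_nonneg_left (hD p q d u r s h t ht) (abs_nonneg _)
  have hab : a * b / (a + b) ≤ a + b := (div_le_iff₀ (by positivity)).2 (by nlinarith)
  -- `slow` is comparable with the total, up to the bounded term with `d`
  have hle : ∀ t, 0 ≤ t → slow a b w d u r s t ≤ (a + b) * (r t + s t + u t) + e := fun t ht => by
    have h1 := (abs_le.1 (hde t ht)).2
    have h2 := mul_le_mul_of_nonneg_right hab (h.u_nonneg t ht)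
    have h3 := mul_nonneg ha.le (h.r_nonneg t ht)
    have h4 := mul_nonneg hb.le (h.s_nonneg t ht)
    unfold slow
    linarith
  have hge : ∀ t, 0 ≤ t →
      r t + s t + u t ≤ 2 * (a + b) / (a * b) * (slow a b w d u r s t + e) := fun t ht => by
    have h1 := (abs_le.1 (hde t ht)).1
    have h3 := h.r_nonneg t ht
    have h4 := h.s_nonneg t ht
    have h5 := h.u_nonneg t ht
    calc r t + s t + u t
        ≤ (r t + s t + u t) + ((1 + 2 * b / a) * r t + (1 + 2 * a / b) * s t + u t) := by
          have : 0 ≤ (1 + 2 * b / a) * r t + (1 + 2 * a / b) * s t + u t := by positivity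
          linarith
      _ = 2 * (a + b) / (a * b) * (b * r t + a * s t + a * b / (a + b) * u t) := by
          field_simp
          ring
      _ ≤ _ := by
          refine mul_le_mul_of_nonneg_left ?_ (by positivity)
          unfold slow
          linarith
  have hbound : ∀ t, 0 ≤ t → slow a b w d u r s t ≤ M + e + θ * L / μ := fun t ht => by
    refine le_of_deriv_le (ν := a * b / (a + b) ^ 2 * μ) (hasDerivAt_slow ha hb h) ?_
      (fun t ht => ?_) ht
    · have h1 := (abs_le.1 (hde 0 le_rfl)).2
      have h2 : 0 ≤ θ * L / μ := by positivity
      have h3 := mul_le_mul_of_nonneg_left h.r_zero_le hb.le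
      have h4 := mul_le_mul_of_nonneg_left h.s_zero_le ha.le
      have h5 := mul_le_mul_of_nonneg_left h.u_zero_le
        (show 0 ≤ a * b / (a + b) by positivity)
      unfold slow
      linarith
    · have h1 := hle t ht
      have h2 : a * b / (a + b) ^ 2 * μ * (θ * L / μ) = 2 * θ := by
        rw [hL]; field_simp
      have h3 : 0 ≤ a * b / (a + b) ^ 2 * μ * M := by positivity
      have h4 : a * b / (a + b) ^ 2 * μ * slow a b w d u r s t
          ≤ a * b / (a + b) ^ 2 * μ * ((a + b) * (r t + s t + u t) + e) :=
        mul_le_mul_of_nonneg_left h1 (by positivity)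
      have h5 : a * b / (a + b) ^ 2 * μ * ((a + b) * (r t + s t + u t) + e)
          = a * b / (a + b) * μ * (r t + s t + u t) + a * b / (a + b) ^ 2 * μ * e := by
        field_simp
      have h6 : a * b / (a + b) ^ 2 * μ * (M + e + θ * L / μ - slow a b w d u r s t)
          = a * b / (a + b) ^ 2 * μ * M + a * b / (a + b) ^ 2 * μ * e
            + a * b / (a + b) ^ 2 * μ * (θ * L / μ)
            - a * b / (a + b) ^ 2 * μ * slow a b w d u r s t := by ring
      rw [h6, h2]
      linarith
  intro t ht
  calc μ * (r t + s t + u t)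
      ≤ μ * (2 * (a + b) / (a * b) * ((M + e + θ * L / μ) + e)) := by
        refine mul_le_mul_of_nonneg_left ((hge t ht).trans ?_) hμ0.le
        exact mul_le_mul_of_nonneg_left (by linarith [hbound t ht]) (by positivity)
    _ = 2 * (a + b) / (a * b) * (μ * (M + 2 * e) + θ * L) := by field_simp; ring
    _ ≤ _ := by
        refine mul_le_mul_of_nonneg_left ?_ (by positivity)
        have := mul_le_mul_of_nonneg_right hμ1 (show 0 ≤ M + 2 * e by positivity)
        linarith

/-- The fast variables, `u` and the difference of the two variances, are bounded. -/
theorem exists_u_le_and_abs_sub_le (ha : 0 < a) (hb : 0 < b) (w C : ℝ) :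
    ∃ K, ∀ p q d u r s, IsMomentSolution a b w C p q d u r s →
      ∀ t, 0 ≤ t → u t ≤ K ∧ |r t - s t| ≤ K := by
  obtain ⟨D, hD⟩ := exists_abs_d_le ha hb w C
  obtain ⟨T, hT⟩ := exists_mul_sum_le ha hb w C
  set G := (a / b + b / a) * T with hG
  set U := C ^ 2 + (2 * |w| * D + G) / (2 * (a + b)) with hU
  set V := C + ((a + b) * U + G) / (a + b) with hV
  refine ⟨max U V, fun p q d u r s h => ?_⟩
  have hp := h.p_pos
  have hq := h.q_pos
  have hC : 0 ≤ C := (abs_nonneg _).trans h.abs_d_zero_le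
  have hD0 : 0 ≤ D := (abs_nonneg _).trans (hD p q d u r s h 0 le_rfl)
  have hsum0 : ∀ t, 0 ≤ t → 0 ≤ r t + s t + u t := fun t ht => by
    linarith [h.r_nonneg t ht, h.s_nonneg t ht, h.u_nonneg t ht]
  have hT0 : 0 ≤ T := (mul_nonneg (by positivity) (hsum0 0 le_rfl)).trans
    (hT p q d u r s h 0 le_rfl)
  have hG0 : 0 ≤ G := by positivity
  have hU0 : 0 ≤ U := by positivity
  -- the terms of order `1 / N` act on a total of order `N`
  have hg : ∀ t, 0 ≤ t → (a * p + b * q) * (r t + s t + u t) ≤ G := fun t ht => by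
    have h1 : a * p + b * q ≤ (a / b + b / a) * (b * p + a * q) := by
      have h2 : (a / b + b / a) * (b * p + a * q)
          = a * p + b * q + (a ^ 2 / b * q + b ^ 2 / a * p) := by field_simp; ring
      have h3 : 0 ≤ a ^ 2 / b * q + b ^ 2 / a * p := by positivity
      linarith
    calc _ ≤ (a / b + b / a) * (b * p + a * q) * (r t + s t + u t) :=
          mul_le_mul_of_nonneg_right h1 (hsum0 t ht)
      _ = (a / b + b / a) * ((b * p + a * q) * (r t + s t + u t)) := by ring
      _ ≤ G := mul_le_mul_of_nonneg_left (hT p q d u r s h t ht) (by positivity)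
  have hu : ∀ t, 0 ≤ t → u t ≤ U := fun t ht => by
    refine le_of_deriv_le (ν := 2 * (a + b)) h.deriv_u ?_ (fun t ht => ?_) ht
    · have : 0 ≤ (2 * |w| * D + G) / (2 * (a + b)) := by positivity
      linarith [h.u_zero_le]
    · have h1 : w * d t ≤ |w| * D := (le_abs_self _).trans (by
        rw [abs_mul]
        exact mul_le_mul_of_nonneg_left (hD p q d u r s h t ht) (abs_nonneg _))
      have h2 := hg t ht
      have h3 : 2 * (a + b) * (U - u t)
          = 2 * (a + b) * C ^ 2 + (2 * |w| * D + G) - 2 * (a + b) * u t := by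
        rw [hU]; field_simp
      have h4 : 0 ≤ 2 * (a + b) * C ^ 2 := by positivity
      rw [h3]
      linarith
  have hr : ∀ t, 0 ≤ t → |r t - s t| ≤ V := fun t ht => by
    refine abs_le_of_abs_deriv_add_le (f := fun t => r t - s t) (ν := a + b)
      (fun t => (h.deriv_r t).sub (h.deriv_s t)) ?_ (fun t ht => ?_) ht
    · have h1 := h.r_nonneg 0 le_rfl
      have h2 := h.s_nonneg 0 le_rfl
      have h3 : 0 ≤ ((a + b) * U + G) / (a + b) := by positivity
      rw [abs_le]
      constructor <;> linarith [h.r_zero_le, h.s_zero_le]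
    · have h1 : (a + b) * V = (a + b) * C + (a + b) * U + G := by rw [hV]; field_simp; ring
      have h2 := hg t ht
      have h3 := mul_nonneg (mul_nonneg ha.le hp.le) (hsum0 t ht)
      have h4 := mul_nonneg (mul_nonneg hb.le hq.le) (hsum0 t ht)
      have h5 := mul_nonneg ha.le (h.u_nonneg t ht)
      have h6 := mul_nonneg hb.le (h.u_nonneg t ht)
      have h7 := mul_le_mul_of_nonneg_left (hu t ht) (add_pos ha hb).le
      have h8 : 0 ≤ (a + b) * C := by positivity
      rw [h1, abs_le]
      constructor <;> linarith
  exact fun t ht => ⟨(hu t ht).trans (le_max_left _ _), (hr t ht).trans (le_max_right _ _)⟩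

/-- Both variances follow the solution `θ / ν * (1 - e ^ (-ν t))` of the relaxation equation at
rate `ν` with production `θ`, up to an error that is bounded uniformly. -/
theorem exists_abs_sub_le (ha : 0 < a) (hb : 0 < b) (w C : ℝ) :
    ∃ K, ∀ p q d u r s, IsMomentSolution a b w C p q d u r s → ∀ ν,
      ν = 2 * a * b / (a + b) ^ 2 * (b * p + a * q) → ∀ t, 0 ≤ t →
      |r t - 2 * a * b * w ^ 2 / (a + b) ^ 3 * ((1 - Real.exp (-ν * t)) / ν)| ≤ K ∧
      |s t - 2 * a * b * w ^ 2 / (a + b) ^ 3 * ((1 - Real.exp (-ν * t)) / ν)| ≤ K := by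
  obtain ⟨D, hD⟩ := exists_abs_d_le ha hb w C
  obtain ⟨F, hF⟩ := exists_u_le_and_abs_sub_le ha hb w C
  set c₁ := |2 * a * b * w / (a + b) ^ 2| with hc₁
  set M := (a + b) * C + a * b / (a + b) * C ^ 2 + c₁ * D + ((a + b) * F + c₁ * D) with hM
  refine ⟨(M + ((a + b) * F + a * b / (a + b) * F + c₁ * D)) / (a + b),
    fun p q d u r s h ν hν => ?_⟩
  have hp := h.p_pos
  have hq := h.q_pos
  have hν0 : 0 < ν := by rw [hν]; positivity
  have hC : 0 ≤ C := (abs_nonneg _).trans h.abs_d_zero_le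
  have hD0 : 0 ≤ D := (abs_nonneg _).trans (hD p q d u r s h 0 le_rfl)
  have hF0 : 0 ≤ F := (h.u_nonneg 0 le_rfl).trans (hF p q d u r s h 0 le_rfl).1
  have hde : ∀ t, 0 ≤ t → |2 * a * b * w / (a + b) ^ 2 * d t| ≤ c₁ * D := fun t ht => by
    rw [abs_mul]
    exact mul_le_mul_of_nonneg_left (hD p q d u r s h t ht) (abs_nonneg _)
  set g : ℝ → ℝ := fun t => 2 * a * b * w ^ 2 / (a + b) ^ 2 * ((1 - Real.exp (-ν * t)) / ν) with hg
  have hgd : ∀ t, HasDerivAt g (2 * a * b * w ^ 2 / (a + b) ^ 2 - ν * g t) t := fun t => by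
    have h1 : HasDerivAt (fun t => Real.exp (-ν * t)) (Real.exp (-ν * t) * (-ν * 1)) t :=
      ((hasDerivAt_id t).const_mul (-ν)).exp
    refine (((h1.const_sub 1).div_const ν).const_mul
      (2 * a * b * w ^ 2 / (a + b) ^ 2)).congr_deriv ?_
    simp only [hg]
    field_simp
    ring
  have hslow : ∀ t, 0 ≤ t → |slow a b w d u r s t - g t| ≤ M := fun t ht => by
    refine abs_le_of_abs_deriv_add_le (f := fun t => slow a b w d u r s t - g t) (ν := ν)
      (fun t => (hasDerivAt_slow ha hb h t).sub (hgd t)) ?_ (fun t ht => ?_) ht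
    · have h1 := abs_le.1 (hde 0 le_rfl)
      have h3 := mul_le_mul_of_nonneg_left h.r_zero_le hb.le
      have h4 := mul_le_mul_of_nonneg_left h.s_zero_le ha.le
      have h5 := mul_le_mul_of_nonneg_left h.u_zero_le
        (show 0 ≤ a * b / (a + b) by positivity)
      have h6 := mul_nonneg hb.le (h.r_nonneg 0 le_rfl)
      have h7 := mul_nonneg ha.le (h.s_nonneg 0 le_rfl)
      have h8 := mul_nonneg (show 0 ≤ a * b / (a + b) by positivity) (h.u_nonneg 0 le_rfl)
      have h9 : 0 ≤ (a + b) * F := by positivity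
      have h10 : 0 ≤ c₁ * D := by positivity
      have h11 : 0 ≤ (a + b) * C + a * b / (a + b) * C ^ 2 := by positivity
      have hg0 : g 0 = 0 := by simp [hg]
      simp only [hg0, sub_zero]
      unfold slow
      rw [abs_le]
      constructor <;> linarith
    · -- the equation of the slow variable closes up to `ν` times a bounded term
      have h1 : 2 * a * b * w ^ 2 / (a + b) ^ 2
          - a * b / (a + b) * (b * p + a * q) * (r t + s t + u t)
          - (2 * a * b * w ^ 2 / (a + b) ^ 2 - ν * g t) + ν * (slow a b w d u r s t - g t)
          = ν * ((b - a) / 2 * (r t - s t) - (a ^ 2 + b ^ 2) / (2 * (a + b)) * u t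
            + 2 * a * b * w / (a + b) ^ 2 * d t) := by
        rw [hν]
        unfold slow
        field_simp
        ring
      rw [h1, abs_mul, abs_of_pos hν0]
      refine mul_le_mul_of_nonneg_left ?_ hν0.le
      obtain ⟨hu, hrs⟩ := hF p q d u r s h t ht
      have hrs' : |(b - a) / 2 * (r t - s t)| ≤ (a + b) / 2 * F := by
        rw [abs_mul]
        refine mul_le_mul ?_ hrs (abs_nonneg _) (by positivity)
        rw [abs_le]
        constructor <;> linarith
      have h2 : (a ^ 2 + b ^ 2) / (2 * (a + b)) ≤ (a + b) / 2 := by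
        rw [div_le_div_iff₀ (by positivity) (by norm_num)]
        nlinarith
      have h3 : (a ^ 2 + b ^ 2) / (2 * (a + b)) * u t ≤ (a + b) / 2 * F :=
        mul_le_mul h2 hu (h.u_nonneg t ht) (by positivity)
      have h4 : 0 ≤ (a ^ 2 + b ^ 2) / (2 * (a + b)) * u t :=
        mul_nonneg (by positivity) (h.u_nonneg t ht)
      have h5 := abs_le.1 (hde t ht)
      have h6 := abs_le.1 hrs'
      have h7 : 0 ≤ (a + b) * C + a * b / (a + b) * C ^ 2 + c₁ * D := by positivity
      rw [abs_le]
      constructor <;> linarith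
  intro t ht
  obtain ⟨hu, hrs⟩ := hF p q d u r s h t ht
  have hgt : 2 * a * b * w ^ 2 / (a + b) ^ 3 * ((1 - Real.exp (-ν * t)) / ν) = g t / (a + b) := by
    simp only [hg]
    field_simp
  -- `(a + b) r = (b r + a s) + a (r - s)` and `(a + b) s = (b r + a s) - b (r - s)`
  have h1 := abs_le.1 (hslow t ht)
  have h2 := abs_le.1 (hde t ht)
  have h3 := mul_le_mul_of_nonneg_left hu (show 0 ≤ a * b / (a + b) by positivity)
  have h4 := mul_nonneg (show 0 ≤ a * b / (a + b) by positivity) (h.u_nonneg t ht)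
  have h5 := abs_le.1 hrs
  have h6 := mul_le_mul_of_nonneg_left h5.1 ha.le
  have h7 := mul_le_mul_of_nonneg_left h5.2 ha.le
  have h8 := mul_le_mul_of_nonneg_left h5.1 hb.le
  have h9 := mul_le_mul_of_nonneg_left h5.2 hb.le
  have h10 : 0 ≤ a * F := by positivity
  have h11 : 0 ≤ b * F := by positivity
  unfold slow at h1
  have key : ∀ y, |(a + b) * y - g t| ≤ M + ((a + b) * F + a * b / (a + b) * F + c₁ * D) →
      |y - g t / (a + b)| ≤ (M + ((a + b) * F + a * b / (a + b) * F + c₁ * D)) / (a + b) := by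
    intro y hy
    have hy' : y - g t / (a + b) = ((a + b) * y - g t) / (a + b) := by field_simp
    rw [hy', abs_div, abs_of_pos (add_pos ha hb)]
    exact div_le_div_of_nonneg_right hy (by positivity)
  rw [hgt]
  refine ⟨key _ ?_, key _ ?_⟩
  · rw [abs_le]
    constructor <;> linarith
  · rw [abs_le]
    constructor <;> linarith

end IsMomentSolution

/-! ### Asymptotics in the number of particles -/

/-- The relaxation function `(1 - e ^ (-ν t)) / ν` depends on its rate `ν` in a relatively
continuous way, uniformly in time. -/
theorem abs_relaxation_sub_le {ν l t : ℝ} (hν : 0 < ν) (hl : 0 < l) (ht : 0 ≤ t) :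
    |(1 - Real.exp (-ν * t)) / ν - (1 - Real.exp (-l * t)) / l|
      ≤ |ν - l| / ν * ((1 - Real.exp (-l * t)) / l) := by
  have hmono : ∀ {x y : ℝ}, x ≤ y → 1 - Real.exp (-x * t) ≤ 1 - Real.exp (-y * t) := fun hxy => by
    have : Real.exp (-_ * t) ≤ Real.exp (-_ * t) := Real.exp_le_exp.2
      (mul_le_mul_of_nonneg_right (neg_le_neg hxy) ht)
    linarith
  -- the relaxation function decreases in its rate, by concavity of `x ↦ 1 - e ^ (-x)`
  have hanti : ∀ {x y : ℝ}, 0 < x → x ≤ y →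
      (1 - Real.exp (-y * t)) / y ≤ (1 - Real.exp (-x * t)) / x := by
    intro x y hx hxy
    have hy : 0 < y := hx.trans_le hxy
    have h1 := convexOn_exp.2 (Set.mem_univ (-y * t)) (Set.mem_univ 0)
      (show 0 ≤ x / y by positivity) (sub_nonneg.2 ((div_le_one hy).2 hxy)) (by ring)
    have h2 : (x / y) • (-y * t) + (1 - x / y) • (0 : ℝ) = -x * t := by
      simp only [smul_eq_mul]; field_simp; ring
    rw [h2] at h1
    simp only [smul_eq_mul, Real.exp_zero, mul_one] at h1
    rw [div_le_div_iff₀ hy hx]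
    have h3 : x / y * Real.exp (-y * t) * y = x * Real.exp (-y * t) := by field_simp
    have h4 : (x / y) * y = x := by field_simp
    have h5 := mul_le_mul_of_nonneg_right h1 hy.le
    nlinarith
  have e : ∀ z : ℝ, z / l - (ν - l) / ν * (z / l) = z / ν := fun z => by field_simp; ring
  rcases le_total l ν with h | h
  · have h1 := hanti hl h
    have h2 := div_le_div_of_nonneg_right (hmono h) hν.le
    rw [abs_of_nonneg (sub_nonneg.2 h), abs_of_nonpos (by linarith)]
    linarith [e (1 - Real.exp (-l * t))]
  · have h1 := hanti hν h
    have h2 := div_le_div_of_nonneg_right (hmono h) hν.le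
    rw [abs_of_nonpos (sub_nonpos.2 h), abs_of_nonneg (by linarith)]
    have h3 := e (1 - Real.exp (-l * t))
    have h4 : -(ν - l) / ν * ((1 - Real.exp (-l * t)) / l)
        = -((ν - l) / ν * ((1 - Real.exp (-l * t)) / l)) := by ring
    rw [h4]
    linarith only [h2, h3]

section Asymptotics

variable {v : Fin 2 → ℝ} {c : Fin 2 → ℝ}

theorem tendsto_sizes_div (hc : ∀ i, 0 < c i) (i : Fin 2) :
    Tendsto (fun N : ℕ => (sizes c N i : ℝ) / N) atTop (𝓝 (c i)) :=
  (tendsto_nat_floor_mul_div_atTop (hc i).le).comp tendsto_natCast_atTop_atTop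

theorem eventually_sizes_pos (hc : ∀ i, 0 < c i) : ∀ᶠ N : ℕ in atTop, ∀ i, 0 < sizes c N i := by
  refine eventually_all.2 fun i => ?_
  filter_upwards [(tendsto_sizes_div hc i).eventually_const_lt (hc i)] with N hN
  by_contra h0
  simp [Nat.eq_zero_of_not_pos h0] at hN

theorem kappa₂_eq (h01 : 0 < α 0 1) (h10 : 0 < α 1 0) (c : Fin 2 → ℝ) :
    kappa₂ α c = 2 * α 0 1 * α 1 0 / (α 0 1 + α 1 0) ^ 2 * (α 1 0 / c 0 + α 0 1 / c 1) := by
  unfold kappa₂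
  congr 1
  field_simp
  ring

theorem kappa₂_pos (h01 : 0 < α 0 1) (h10 : 0 < α 1 0) (hc : ∀ i, 0 < c i) : 0 < kappa₂ α c := by
  have := hc 0
  have := hc 1
  rw [kappa₂_eq h01 h10]
  positivity

theorem hConst_pos (hv : v 0 ≠ v 1) (h01 : 0 < α 0 1) (h10 : 0 < α 1 0) (hc : ∀ i, 0 < c i) :
    0 < hConst v α c := by
  have := kappa₂_pos h01 h10 hc
  have : 0 < (v 0 - v 1) ^ 2 := by have := sub_ne_zero.2 hv; positivity
  unfold hConst
  positivity

/-- The relaxation rate of a system of `N` particles, multiplied by `N`, tends to `ϰ₂`. -/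
theorem tendsto_mul_rate (h01 : 0 < α 0 1) (h10 : 0 < α 1 0) (hc : ∀ i, 0 < c i) :
    Tendsto (fun N : ℕ => N * (2 * α 0 1 * α 1 0 / (α 0 1 + α 1 0) ^ 2 *
      (α 1 0 * (1 / (sizes c N 0 : ℝ)) + α 0 1 * (1 / (sizes c N 1 : ℝ))))) atTop
      (𝓝 (kappa₂ α c)) := by
  rw [kappa₂_eq h01 h10]
  have h0 := (tendsto_const_nhds (x := α 1 0)).div (tendsto_sizes_div hc 0) (hc 0).ne'
  have h1 := (tendsto_const_nhds (x := α 0 1)).div (tendsto_sizes_div hc 1) (hc 1).ne'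
  refine ((h0.add h1).const_mul (2 * α 0 1 * α 1 0 / (α 0 1 + α 1 0) ^ 2)).congr fun N => ?_
  simp only [div_div_eq_mul_div, Pi.div_apply]
  ring

/-- The expected empirical variances follow `h N (1 - e ^ (-ϰ₂ t / N))` up to a small relative
error and a bounded absolute error, uniformly in time. All regimes are special cases. -/
theorem eventually_abs_R_sub_le (hv : v 0 ≠ v 1) (h00 : α 0 0 = 0) (h11 : α 1 1 = 0)
    (h01 : 0 < α 0 1) (h10 : 0 < α 1 0) (hc : ∀ i, 0 < c i)
    (x₀ : ∀ N : ℕ, Config (sizes c N)) (C : ℝ)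
    (hS : ∀ N i, empVar (sizes c N) i (x₀ N) ≤ C)
    (hl : ∀ N, |empMean (sizes c N) 0 (x₀ N) - empMean (sizes c N) 1 (x₀ N)| ≤ C) :
    ∃ K : ℝ, 0 ≤ K ∧ ∀ η : ℝ, 0 < η → ∀ᶠ N : ℕ in atTop, 0 < N ∧ ∀ i t, 0 ≤ t →
      |R (sizes c N) v α (x₀ N) i t
          - hConst v α c * (1 - Real.exp (-kappa₂ α c * (t / N))) * N|
        ≤ η * (hConst v α c * (1 - Real.exp (-kappa₂ α c * (t / N))) * N) + K := by
  obtain ⟨K, hK⟩ := IsMomentSolution.exists_abs_sub_le h01 h10 (v 0 - v 1) C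
  have hκ := kappa₂_pos h01 h10 hc
  have hh := hConst_pos hv h01 h10 hc
  refine ⟨max K 0, le_max_right _ _, fun η hη => ?_⟩
  set rate : ℕ → ℝ := fun N => 2 * α 0 1 * α 1 0 / (α 0 1 + α 1 0) ^ 2 *
      (α 1 0 * (1 / (sizes c N 0 : ℝ)) + α 0 1 * (1 / (sizes c N 1 : ℝ))) with hrate
  have hlim : Tendsto (fun N : ℕ => |N * rate N - kappa₂ α c| / (N * rate N)) atTop (𝓝 0) := by
    have h1 := tendsto_mul_rate h01 h10 hc
    have h2 := (h1.sub_const (kappa₂ α c)).abs.div h1 hκ.ne'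
    simpa only [sub_self, abs_zero, zero_div] using! h2
  filter_upwards [eventually_gt_atTop 0, eventually_sizes_pos hc,
    hlim.eventually_le_const hη] with N hN hsz hrel
  have hN' : (0 : ℝ) < N := by exact_mod_cast hN
  have hrate0 : 0 < rate N := by
    have h0 : (0 : ℝ) < sizes c N 0 := by exact_mod_cast hsz 0
    have h1 : (0 : ℝ) < sizes c N 1 := by exact_mod_cast hsz 1
    simp only [hrate]
    positivity
  refine ⟨hN, fun i t ht => ?_⟩
  obtain ⟨d, u, r, s, hsol, hr, hs⟩ :=
    exists_isMomentSolution h00 h11 h01 h10 hsz v (x₀ N) (hS N) (hl N)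
  have hsol' := hK _ _ d u r s hsol (rate N) rfl t ht
  have hR : |R (sizes c N) v α (x₀ N) i t - 2 * α 0 1 * α 1 0 * (v 0 - v 1) ^ 2
      / (α 0 1 + α 1 0) ^ 3 * ((1 - Real.exp (-rate N * t)) / rate N)| ≤ K := by
    match i with
    | 0 => rw [hr t ht]; exact hsol'.1
    | 1 => rw [hs t ht]; exact hsol'.2
  set θ := 2 * α 0 1 * α 1 0 * (v 0 - v 1) ^ 2 / (α 0 1 + α 1 0) ^ 3 with hθ
  have hθ0 : 0 ≤ θ := by positivity
  have hθh : θ = hConst v α c * kappa₂ α c := by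
    unfold hConst
    field_simp
    rw [hθ]
    field_simp
  have hrelax := abs_relaxation_sub_le hrate0 (div_pos hκ hN') ht
  have hG : hConst v α c * (1 - Real.exp (-kappa₂ α c * (t / N))) * N
      = θ * ((1 - Real.exp (-(kappa₂ α c / N) * t)) / (kappa₂ α c / N)) := by
    rw [hθh, show -(kappa₂ α c / N) * t = -kappa₂ α c * (t / N) by ring]
    field_simp
  rw [hG]
  set φ := (1 - Real.exp (-(kappa₂ α c / N) * t)) / (kappa₂ α c / N) with hφ
  have hφ0 : 0 ≤ φ := by
    refine div_nonneg (sub_nonneg.2 (Real.exp_le_one_iff.2 ?_)) (by positivity)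
    have : 0 ≤ kappa₂ α c / N * t := by positivity
    linarith
  have hrel' : |rate N - kappa₂ α c / N| / rate N ≤ η := by
    have : |rate N - kappa₂ α c / N| / rate N = |N * rate N - kappa₂ α c| / (N * rate N) := by
      rw [show N * rate N - kappa₂ α c = N * (rate N - kappa₂ α c / N) by field_simp, abs_mul,
        abs_of_pos hN']
      field_simp
    rw [this]
    exact hrel
  have h1 : |θ * ((1 - Real.exp (-rate N * t)) / rate N) - θ * φ| ≤ η * (θ * φ) := by
    rw [← mul_sub, abs_mul, abs_of_nonneg hθ0]
    calc θ * |(1 - Real.exp (-rate N * t)) / rate N - φ| ≤ θ * (η * φ) :=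
          mul_le_mul_of_nonneg_left
            (hrelax.trans (mul_le_mul_of_nonneg_right hrel' hφ0)) hθ0
      _ = η * (θ * φ) := by ring
  have h2 := abs_sub_le (R (sizes c N) v α (x₀ N) i t)
    (θ * ((1 - Real.exp (-rate N * t)) / rate N)) (θ * φ)
  linarith [le_max_left K 0]

end Asymptotics

theorem isEquivalent_of_eventually_abs_sub_le {f g : ℕ → ℝ}
    (h : ∀ ε : ℝ, 0 < ε → ∀ᶠ N in atTop, |f N - g N| ≤ ε * g N) : f ~[atTop] g := by
  refine isLittleO_iff.2 fun ε hε => ?_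
  filter_upwards [h ε hε] with N hN
  exact hN.trans (mul_le_mul_of_nonneg_left (le_abs_self _) hε.le)

/-! ### The three regimes of a quantity with relaxation profile -/

section Regimes

variable {r : ℕ → ℝ → ℝ} {h κ K : ℝ}

theorem linear_regime (hh : 0 < h) (hκ : 0 < κ) (hK : 0 ≤ K)
    (H : ∀ η : ℝ, 0 < η → ∀ᶠ N : ℕ in atTop, 0 < N ∧ ∀ t, 0 ≤ t →
      |r N t - h * (1 - Real.exp (-κ * (t / N))) * N|
        ≤ η * (h * (1 - Real.exp (-κ * (t / N))) * N) + K) {ε : ℝ} (hε : 0 < ε) :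
    ∃ δ : ℝ, 0 < δ ∧ ∃ T : ℝ, ∃ N₀ : ℕ, ∀ N ≥ N₀, ∀ t : ℝ, T ≤ t → t ≤ δ * N →
      |r N t - h * κ * t| ≤ ε * (h * κ * t) := by
  obtain ⟨N₀, hN₀⟩ := eventually_atTop.1 (H (ε / 3) (by positivity))
  refine ⟨ε / (3 * κ), by positivity, 3 * K / (ε * (h * κ)), N₀, fun N hN t hT ht => ?_⟩
  obtain ⟨hN0, hR⟩ := hN₀ N hN
  have hN' : (0 : ℝ) < N := by exact_mod_cast hN0
  have ht0 : 0 ≤ t := le_trans (by positivity) hT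
  have hKt : K ≤ ε / 3 * (h * κ * t) := by
    have := (div_le_iff₀ (by positivity)).1 hT
    linarith
  set x := κ * (t / N) with hx
  have hx0 : 0 ≤ x := by positivity
  have hxε : x ≤ ε / 3 := by
    have h1 : t / N ≤ ε / (3 * κ) := (div_le_iff₀ hN').2 ht
    calc x ≤ κ * (ε / (3 * κ)) := mul_le_mul_of_nonneg_left h1 hκ.le
      _ = ε / 3 := by field_simp
  have hexp1 : 1 - Real.exp (-κ * (t / N)) ≤ x := by
    have := Real.add_one_le_exp (-κ * (t / N))
    linarith
  -- from `e ^ (-x) ≤ 1 / (1 + x) ≤ 1 - x + x ^ 2`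
  have hexp2 : x - x ^ 2 ≤ 1 - Real.exp (-κ * (t / N)) := by
    have h1 := Real.add_one_le_exp x
    have h2 : Real.exp (-κ * (t / N)) * Real.exp x = 1 := by
      rw [← Real.exp_add, hx]; simp
    have h3 : 0 < Real.exp (-κ * (t / N)) := Real.exp_pos _
    have h4 : Real.exp (-κ * (t / N)) * (x + 1) ≤ 1 := by nlinarith
    by_contra hcon
    have h5 : 1 - x + x ^ 2 < Real.exp (-κ * (t / N)) := by linarith
    have h6 : (1 - x + x ^ 2) * (x + 1) = 1 + x ^ 3 := by ring
    have h7 : (1 - x + x ^ 2) * (x + 1) < Real.exp (-κ * (t / N)) * (x + 1) :=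
      mul_lt_mul_of_pos_right h5 (by linarith)
    have h8 : 0 ≤ x ^ 3 := by positivity
    linarith
  have hxN : x * N = κ * t := by rw [hx]; field_simp
  set G := h * (1 - Real.exp (-κ * (t / N))) * N with hG
  have hG1 : G ≤ h * κ * t := by
    have : G ≤ h * x * N :=
      mul_le_mul_of_nonneg_right (mul_le_mul_of_nonneg_left hexp1 hh.le) hN'.le
    rwa [mul_assoc, hxN, ← mul_assoc] at this
  have hG2 : h * κ * t - ε / 3 * (h * κ * t) ≤ G := by
    have h1 : h * (x - x ^ 2) * N ≤ G :=
      mul_le_mul_of_nonneg_right (mul_le_mul_of_nonneg_left hexp2 hh.le) hN'.le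
    have h2 : h * (x - x ^ 2) * N = h * κ * t - x * (h * κ * t) := by
      calc h * (x - x ^ 2) * N = h * (x * N) - x * (h * (x * N)) := by ring
        _ = _ := by rw [hxN]; ring
    have h3 : x * (h * κ * t) ≤ ε / 3 * (h * κ * t) :=
      mul_le_mul_of_nonneg_right hxε (by positivity)
    linarith
  have h1 := abs_le.1 (hR t ht0)
  have h2 : ε / 3 * G ≤ ε / 3 * (h * κ * t) := mul_le_mul_of_nonneg_left hG1 (by positivity)
  rw [abs_le]
  constructor <;> linarith

theorem exponential_regime (hh : 0 < h) (hκ : 0 < κ)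
    (H : ∀ η : ℝ, 0 < η → ∀ᶠ N : ℕ in atTop, 0 < N ∧ ∀ t, 0 ≤ t →
      |r N t - h * (1 - Real.exp (-κ * (t / N))) * N|
        ≤ η * (h * (1 - Real.exp (-κ * (t / N))) * N) + K)
    {ε s₀ : ℝ} (hε : 0 < ε) (hs₀ : 0 < s₀) :
    ∃ N₀ : ℕ, ∀ N ≥ N₀, ∀ s : ℝ, s₀ ≤ s →
      |r N (s * N) - h * (1 - Real.exp (-κ * s)) * N|
        ≤ ε * (h * (1 - Real.exp (-κ * s)) * N) := by
  have h0 : 0 < 1 - Real.exp (-κ * s₀) := by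
    have : Real.exp (-κ * s₀) < 1 := Real.exp_lt_one_iff.2 (by nlinarith)
    linarith
  have hlarge : ∀ᶠ N : ℕ in atTop, K / (ε / 2 * (h * (1 - Real.exp (-κ * s₀)))) ≤ N :=
    tendsto_natCast_atTop_atTop.eventually_ge_atTop _
  obtain ⟨N₀, hN₀⟩ := eventually_atTop.1 ((H (ε / 2) (by positivity)).and hlarge)
  refine ⟨N₀, fun N hN s hs => ?_⟩
  obtain ⟨⟨hN0, hR⟩, hK⟩ := hN₀ N hN
  have hN' : (0 : ℝ) < N := by exact_mod_cast hN0
  have h1 := hR (s * N) (by have := hs₀.le.trans hs; positivity)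
  rw [mul_div_assoc, div_self hN'.ne', mul_one] at h1
  have h2 := (div_le_iff₀ (by positivity)).1 hK
  have h3 : 1 - Real.exp (-κ * s₀) ≤ 1 - Real.exp (-κ * s) := by
    have : Real.exp (-κ * s) ≤ Real.exp (-κ * s₀) := Real.exp_le_exp.2 (by nlinarith)
    linarith
  have h4 : ε / 2 * (h * (1 - Real.exp (-κ * s₀)) * N)
      ≤ ε / 2 * (h * (1 - Real.exp (-κ * s)) * N) := by gcongr
  linarith

theorem saturated_regime (hh : 0 < h) (hκ : 0 < κ)
    (H : ∀ η : ℝ, 0 < η → ∀ᶠ N : ℕ in atTop, 0 < N ∧ ∀ t, 0 ≤ t →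
      |r N t - h * (1 - Real.exp (-κ * (t / N))) * N|
        ≤ η * (h * (1 - Real.exp (-κ * (t / N))) * N) + K)
    {ε : ℝ} (hε : 0 < ε) :
    ∃ L : ℝ, 0 < L ∧ ∃ N₀ : ℕ, ∀ N ≥ N₀, ∀ t : ℝ, L * N ≤ t →
      |r N t - h * N| ≤ ε * (h * N) := by
  have hlarge : ∀ᶠ N : ℕ in atTop, K / (ε / 3 * h) ≤ N :=
    tendsto_natCast_atTop_atTop.eventually_ge_atTop _
  have hexp : ∀ᶠ L : ℝ in atTop, Real.exp (-κ * L) ≤ ε / 3 := by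
    have : Tendsto (fun L : ℝ => Real.exp (-κ * L)) atTop (𝓝 0) :=
      Real.tendsto_exp_atBot.comp (tendsto_id.const_mul_atTop_of_neg (neg_lt_zero.2 hκ))
    exact this.eventually_le_const (by positivity)
  obtain ⟨L, hL, hL0⟩ := (hexp.and (eventually_gt_atTop 0)).exists
  obtain ⟨N₀, hN₀⟩ := eventually_atTop.1 ((H (ε / 3) (by positivity)).and hlarge)
  refine ⟨L, hL0, N₀, fun N hN t ht => ?_⟩
  obtain ⟨⟨hN0, hR⟩, hK⟩ := hN₀ N hN
  have hN' : (0 : ℝ) < N := by exact_mod_cast hN0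
  have h1 := abs_le.1 (hR t ((by positivity : 0 ≤ L * N).trans ht))
  have h2 := (div_le_iff₀ (by positivity)).1 hK
  have h3 : Real.exp (-κ * (t / N)) ≤ ε / 3 := by
    have : L ≤ t / N := (le_div_iff₀ hN').2 ht
    exact (Real.exp_le_exp.2 (by nlinarith)).trans hL
  have h4 := Real.exp_pos (-κ * (t / N))
  have hhN : 0 < h * N := by positivity
  have h5 := mul_le_mul_of_nonneg_right h3 hhN.le
  have h6 : 0 < Real.exp (-κ * (t / N)) * (h * N) := by positivity
  have h7 : h * (1 - Real.exp (-κ * (t / N))) * N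
      = h * N - Real.exp (-κ * (t / N)) * (h * N) := by ring
  rw [h7] at h1
  have h8 : ε / 3 * (h * N - Real.exp (-κ * (t / N)) * (h * N)) ≤ ε / 3 * (h * N) :=
    mul_le_mul_of_nonneg_left (by linarith) (by positivity)
  rw [abs_le]
  constructor <;> linarith

end Regimes

end TimeSync

theorem theorem2 (v : Fin 2 → ℝ) (hv : v 0 ≠ v 1)
    (α : Fin 2 → Fin 2 → ℝ) (h00 : α 0 0 = 0) (h11 : α 1 1 = 0)
    (h01 : 0 < α 0 1) (h10 : 0 < α 1 0)
    (c : Fin 2 → ℝ) (hc : ∀ i, 0 < c i) (hc1 : c 0 + c 1 = 1)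
    -- the initial coordinates for every `N`, with `S_i²(0)` and the distance of the two
    -- mass centres at time `0` bounded uniformly in `N`
    (x₀ : ∀ N : ℕ, TimeSync.Config (TimeSync.sizes c N)) (C : ℝ)
    (hS : ∀ N i, TimeSync.empVar (TimeSync.sizes c N) i (x₀ N) ≤ C)
    (hl : ∀ N, |TimeSync.empMean (TimeSync.sizes c N) 0 (x₀ N)
      - TimeSync.empMean (TimeSync.sizes c N) 1 (x₀ N)| ≤ C) :
    let R : Fin 2 → ℕ → ℝ → ℝ := fun i N t => TimeSync.R (TimeSync.sizes c N) v α (x₀ N) i t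
    let κ : ℝ := TimeSync.kappa₂ α c
    let h : ℝ := TimeSync.hConst v α c
    0 < κ ∧
    -- the three regimes
    (∀ i : Fin 2,
      (∀ t : ℕ → ℝ, Tendsto t atTop atTop → Tendsto (fun N : ℕ => t N / N) atTop (𝓝 0) →
        (fun N : ℕ => R i N (t N)) ~[atTop] fun N : ℕ => h * κ * t N) ∧
      (∀ s : ℝ, 0 < s →
        (fun N : ℕ => R i N (s * N)) ~[atTop] fun N : ℕ => h * (1 - Real.exp (-κ * s)) * N) ∧
      (∀ t : ℕ → ℝ, Tendsto (fun N : ℕ => t N / N) atTop atTop →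
        (fun N : ℕ => R i N (t N)) ~[atTop] fun N : ℕ => h * N)) ∧
    -- and they hold uniformly in the time
    (∀ i : Fin 2, ∀ ε : ℝ, 0 < ε →
      (∃ δ : ℝ, 0 < δ ∧ ∃ T : ℝ, ∃ N₀ : ℕ, ∀ N ≥ N₀, ∀ t : ℝ, T ≤ t → t ≤ δ * N →
        |R i N t - h * κ * t| ≤ ε * (h * κ * t)) ∧
      (∀ s₀ : ℝ, 0 < s₀ → ∃ N₀ : ℕ, ∀ N ≥ N₀, ∀ s : ℝ, s₀ ≤ s →
        |R i N (s * N) - h * (1 - Real.exp (-κ * s)) * N|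
          ≤ ε * (h * (1 - Real.exp (-κ * s)) * N)) ∧
      (∃ K : ℝ, 0 < K ∧ ∃ N₀ : ℕ, ∀ N ≥ N₀, ∀ t : ℝ, K * N ≤ t →
        |R i N t - h * N| ≤ ε * (h * N))) := by
  intro R κ h
  have hκ : 0 < κ := TimeSync.kappa₂_pos h01 h10 hc
  have hh : 0 < h := TimeSync.hConst_pos hv h01 h10 hc
  obtain ⟨K, hK, H'⟩ :=
    TimeSync.eventually_abs_R_sub_le hv h00 h11 h01 h10 hc x₀ C hS hl
  have H : ∀ i : Fin 2, ∀ η : ℝ, 0 < η → ∀ᶠ N : ℕ in atTop, 0 < N ∧ ∀ t, 0 ≤ t →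
      |R i N t - h * (1 - Real.exp (-κ * (t / N))) * N|
        ≤ η * (h * (1 - Real.exp (-κ * (t / N))) * N) + K := fun i η hη => by
    filter_upwards [H' η hη] with N hN
    exact ⟨hN.1, hN.2 i⟩
  have U1 := fun i (ε : ℝ) (hε : 0 < ε) => TimeSync.linear_regime hh hκ hK (H i) hε
  have U2 := fun i (ε : ℝ) (hε : 0 < ε) (s₀ : ℝ) (hs₀ : 0 < s₀) =>
    TimeSync.exponential_regime hh hκ (H i) hε hs₀
  have U3 := fun i (ε : ℝ) (hε : 0 < ε) => TimeSync.saturated_regime hh hκ (H i) hε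
  refine ⟨hκ, fun i => ⟨fun t ht htN => ?_, fun s hs => ?_, fun t htN => ?_⟩,
    fun i ε hε => ⟨U1 i ε hε, U2 i ε hε, U3 i ε hε⟩⟩
  · refine TimeSync.isEquivalent_of_eventually_abs_sub_le fun ε hε => ?_
    obtain ⟨δ, hδ, T, N₀, hU⟩ := U1 i ε hε
    filter_upwards [ht.eventually_ge_atTop T, htN.eventually_le_const hδ,
      eventually_ge_atTop N₀, eventually_gt_atTop 0] with N h1 h2 h3 h4
    exact hU N h3 _ h1 ((div_le_iff₀ (by exact_mod_cast h4)).1 h2)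
  · refine TimeSync.isEquivalent_of_eventually_abs_sub_le fun ε hε => ?_
    obtain ⟨N₀, hU⟩ := U2 i ε hε s hs
    filter_upwards [eventually_ge_atTop N₀] with N h1
    exact hU N h1 s le_rfl
  · refine TimeSync.isEquivalent_of_eventually_abs_sub_le fun ε hε => ?_
    obtain ⟨L, hL, N₀, hU⟩ := U3 i ε hε
    filter_upwards [htN.eventually_ge_atTop L, eventually_ge_atTop N₀,
      eventually_gt_atTop 0] with N h1 h2 h3
    exact hU N h2 _ ((le_div_iff₀ (by exact_mod_cast h3)).1 h1)
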